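/- **Setting.** Let $N\ge 1$, let $\alpha_1,\dots,\alpha_N\in\mathbb C$ be mutually distinct with imaginary parts all positive or all negative, and let $c_1,\dots,c_N\in\mathbb C$ be arbitrary. Write $'=\partial_s$ and $\dot{}=\partial_t$ for $s,t\in\mathbb R$. For $\lambda\in\mathbb C^\times$ put $$e(s,t,\lambda)=\exp\!\Big(\tfrac i2(\lambda s+\lambda^{-1}t)\Big),$$ $A=(\alpha_j^{\,k-1})_{j,k=1}^N$, $E=\operatorname{diag}(e(s,t,\alpha_j))$, $C=\operatorname{diag}(c_j)$, and $$T_0=\begin{pmatrix}EA&-CE^{-1}A\\ \overline{CE^{-1}A}&\overline{EA}\end{pmatrix},\qquad b=-\big(\alpha_1^Ne(s,t,\alpha_1),\dots,\alpha_N^Ne(s,t,\alpha_N),\ \overline{\alpha_1}^N\overline{c_1}\,e(s,t,\overline{\alpha_1}),\dots,\overline{\alpha_N}^N\overline{c_N}\,e(s,t,\overline{\alpha_N})\big)^{\mathsf T}.$$ For $1\le k\le 2N$ let $T_k$ be $T_0$ with its $k$-th column replaced by $b$, and let $d_k=d_k(s,t)=\det T_k$ for $0\le k\le 2N$. Date's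 wave function is the matrix $\Psi=(\Psi_{ij}(s,t,\lambda))_{i,j=1,2}$ with $$\Psi_{11}=\Big(\lambda^N+\sum_{j=0}^{N-1}\tfrac{d_{j+1}}{d_0}\lambda^j\Big)e(s,t,\lambda),\quad \Psi_{21}=-\Big(\sum_{j=0}^{N-1}\tfrac{d_{N+j+1}}{d_0}\lambda^j\Big)e(s,t,\lambda)^{-1},$$ $$\Psi_{12}(s,t,\lambda)=-\overline{\Psi_{21}(s,t,\bar\lambda)},\quad \Psi_{22}(s,t,\lambda)=\overline{\Psi_{11}(s,t,\bar\lambda)}.$$ Put $f(s,t,\lambda)=\Psi_{11}(s,t,\lambda)\,e(s,t,-\lambda)$, $g(s,t,\lambda)=\Psi_{21}(s,t,\lambda)\,e(s,t,\lambda)$, $q=2i\,\overline{d_{2N}/d_0}$, and, for $\lambda>0$, $F=\Psi/\sqrt{\det\Psi}$. Identify $\mathbb R^3$ with $\mathfrak{su}(2)$ by $$(p_1,p_2,p_3)^{\mathsf T}\longleftrightarrow\frac12\begin{pmatrix} ip_3&-p_1-ip_2\\ p_1-ip_2&-ip_3\end{pmatrix}.$$ The $N$-soliton curve $\gamma=(\gamma_1,\gamma_2,\gamma_3)^{\mathsf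 T}$ is the map $\gamma(s,t)=\lambda(\partial_\lambda F)F^{-1}\big|_{\lambda=1}$ read in $\mathbb R^3$. **Statement.** The following hold for all $s,t\in\mathbb R$. 1. $d_0\neq0$; $(1,c_j)\Psi(s,t,\alpha_j)=0$ for all $j$; and for every $\lambda\in\mathbb C^\times$ $$\Psi'=\Psi\cdot\frac12\begin{pmatrix}i\lambda&2i\,\overline{d_{2N}/d_0}\\ 2i\,d_{2N}/d_0&-i\lambda\end{pmatrix},\qquad \dot\Psi=\Psi\cdot\frac{i}{2\lambda(|d_1|^2+|d_{N+1}|^2)}\begin{pmatrix}|d_1|^2-|d_{N+1}|^2&2\overline{d_1d_{N+1}}\\2d_1d_{N+1}&-|d_1|^2+|d_{N+1}|^2\end{pmatrix}.$$ 2. For $\lambda\in\mathbb C^\times$, $f=\lambda^N+\sum_{j=0}^{N-1}\frac{d_{j+1}}{d_0}\lambda^j$ and $g=-\sum_{j=0}^{N-1}\frac{d_{N+j+1}}{d_0}\lambda^j$. 3. For $\lambda>0$, $\det\Psi=|f|^2+|g|^2>0$, and $F$ is a smooth function of $(s,t,\lambda)$ with values in $\mathrm{SU}(2)$. The function $q$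 is a smooth solution of the Pohlmeyer–Lund–Regge equation $\dot q'+\frac12 q\,h=0$ for some real function $h$ with $h'=(|q|^2)^{\boldsymbol\cdot}$, and, with the same $h$, for all $\lambda>0$ $$F'=F\cdot\frac12\begin{pmatrix}i\lambda&q\\-\bar q&-i\lambda\end{pmatrix},\qquad \dot F=F\cdot\frac{i}{2\lambda}\begin{pmatrix}h/2&-\dot q\\-\dot{\bar q}&-h/2\end{pmatrix}.$$ 4. $\lambda(\partial_\lambda F)F^{-1}|_{\lambda=1}\in\mathfrak{su}(2)$, and $\gamma$ is a smooth Lund–Regge evolution of unit speed: $\dot\gamma'=\gamma'\times\dot\gamma$ and $|\gamma'|=1$. 5. Explicitly (with $\lambda$ real in $\partial_\lambda$), $$\gamma_1=2\,\Re\!\left[\frac{\bar f\,\partial_\lambda g-g\,\partial_\lambda\bar f}{f\bar f+g\bar g}\,\bar e^{\,2}\right]_{\lambda=1},\qquad \gamma_2=-2\,\Im\!\left[\frac{\bar f\,\partial_\lambda g-g\,\partial_\lambda\bar f}{f\bar f+g\bar g}\,\bar e^{\,2}\right]_{\lambda=1},$$ $$\gamma_3=s-t+2\,\Im\!\left[\frac{\bar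 f\,\partial_\lambda f+g\,\partial_\lambda\bar g}{f\bar f+g\bar g}\right]_{\lambda=1}.$$ -/

import Mathlib

open scoped ContDiff ComplexConjugate

noncomputable section

namespace LundRegge

/-- The exponential `e(s,t,λ) = exp((i/2)(λ s + λ⁻¹ t))`. -/
def expFun (s t : ℝ) (l : ℂ) : ℂ :=
  Complex.exp (Complex.I / 2 * (l * (s : ℂ) + l⁻¹ * (t : ℂ)))

section Date

variable {N : ℕ} (α c : Fin N → ℂ)

/-- The block `E A`, with `A` the Vandermonde matrix `(α_j ^ k)` and `E = diag(e(α_j))`. -/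
def blockEA (s t : ℝ) : Matrix (Fin N) (Fin N) ℂ :=
  Matrix.diagonal (fun j => expFun s t (α j)) * Matrix.vandermonde α

/-- The block `C E⁻¹ A`, with `C = diag(c_j)`. -/
def blockCEA (s t : ℝ) : Matrix (Fin N) (Fin N) ℂ :=
  Matrix.diagonal c * Matrix.diagonal (fun j => (expFun s t (α j))⁻¹) * Matrix.vandermonde α

/-- The `2N × 2N` coefficient matrix `T₀`. -/
def coeffMatrix (s t : ℝ) : Matrix (Fin N ⊕ Fin N) (Fin N ⊕ Fin N) ℂ :=
  Matrix.fromBlocks (blockEA α s t) (-blockCEA α c s t)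
    ((blockCEA α c s t).map conj) ((blockEA α s t).map conj)

/-- The right-hand side `b` of the linear system `T₀ ψ = b`. -/
def rhsVec (s t : ℝ) : Fin N ⊕ Fin N → ℂ :=
  Sum.elim (fun j => -((α j) ^ N * expFun s t (α j)))
    (fun j => -((conj (α j)) ^ N * conj (c j) * expFun s t (conj (α j))))

/-- The position in `{1, …, 2N}` of a column of `T₀`. -/
def colNumber : Fin N ⊕ Fin N → ℕ :=
  Sum.elim (fun j => (j : ℕ) + 1) (fun j => N + (j : ℕ) + 1)

/-- `T_k`: the matrix `T₀` with its `k`-th column replaced by `b` when `1 ≤ k ≤ 2N`;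
for `k = 0` it is `T₀` itself, as no column has number `0`. -/
def cramerMatrix (k : ℕ) (s t : ℝ) : Matrix (Fin N ⊕ Fin N) (Fin N ⊕ Fin N) ℂ :=
  Matrix.of fun i j => if colNumber j = k then rhsVec α c s t i else coeffMatrix α c s t i j

/-- `d_k = det T_k`. -/
def d (k : ℕ) (s t : ℝ) : ℂ := (cramerMatrix α c k s t).det

/-- The entry `Ψ₁₁` of the wave function. -/
def Psi11 (s t : ℝ) (l : ℂ) : ℂ :=
  (l ^ N + ∑ j : Fin N, d α c ((j : ℕ) + 1) s t / d α c 0 s t * l ^ (j : ℕ)) *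
    Complex.exp (Complex.I / 2 * (l * (s : ℂ) + l⁻¹ * (t : ℂ)))

/-- The entry `Ψ₂₁` of the wave function. -/
def Psi21 (s t : ℝ) (l : ℂ) : ℂ :=
  -(∑ j : Fin N, d α c (N + (j : ℕ) + 1) s t / d α c 0 s t * l ^ (j : ℕ)) *
    Complex.exp (-(Complex.I / 2 * (l * (s : ℂ) + l⁻¹ * (t : ℂ))))

/-- Date's `N`-soliton wave function; `Ψ₁₂(λ) = -conj Ψ₂₁(conj λ)`,
`Ψ₂₂(λ) = conj Ψ₁₁(conj λ)`. -/
def Psi (s t : ℝ) (l : ℂ) : Matrix (Fin 2) (Fin 2) ℂ :=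
  !![Psi11 α c s t l, -conj (Psi21 α c s t (conj l));
     Psi21 α c s t l, conj (Psi11 α c s t (conj l))]

/-- `f(s,t,λ) = Ψ₁₁(s,t,λ) e(s,t,-λ)`. -/
def f (s t : ℝ) (l : ℂ) : ℂ := Psi α c s t l 0 0 * expFun s t (-l)

/-- `g(s,t,λ) = Ψ₂₁(s,t,λ) e(s,t,λ)`. -/
def g (s t : ℝ) (l : ℂ) : ℂ := Psi α c s t l 1 0 * expFun s t l

/-- The coefficient `Ψ⁻¹ Ψ'` of Date's Lax pair, in terms of the determinants. -/
def dateL (s t : ℝ) (l : ℂ) : Matrix (Fin 2) (Fin 2) ℂ :=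
  (1 / 2 : ℂ) • !![Complex.I * l, 2 * Complex.I * conj (d α c (2 * N) s t / d α c 0 s t);
    2 * Complex.I * (d α c (2 * N) s t / d α c 0 s t), -(Complex.I * l)]

/-- The coefficient of `Ψ⁻¹` times the `t`-derivative of `Ψ` in Date's Lax pair. -/
def dateM (s t : ℝ) (l : ℂ) : Matrix (Fin 2) (Fin 2) ℂ :=
  (Complex.I / (2 * l * ((‖d α c 1 s t‖ ^ 2 + ‖d α c (N + 1) s t‖ ^ 2 : ℝ) : ℂ))) •
    !![((‖d α c 1 s t‖ ^ 2 - ‖d α c (N + 1) s t‖ ^ 2 : ℝ) : ℂ),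
        2 * conj (d α c 1 s t * d α c (N + 1) s t);
      2 * (d α c 1 s t * d α c (N + 1) s t),
        ((-‖d α c 1 s t‖ ^ 2 + ‖d α c (N + 1) s t‖ ^ 2 : ℝ) : ℂ)]

/-- The `N`-soliton solution `q` of the Pohlmeyer-Lund-Regge equation. -/
def solitonSolution (s t : ℝ) : ℂ :=
  2 * Complex.I * conj (d α c (2 * N) s t / d α c 0 s t)

/-- The normalized wave function `F = Ψ / √(det Ψ)` for a real spectral parameter
(where `det Ψ` is a positive real number). -/
def frame (s t l : ℝ) : Matrix (Fin 2) (Fin 2) ℂ :=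
  ((Real.sqrt (Psi α c s t (l : ℂ)).det.re : ℝ) : ℂ)⁻¹ • Psi α c s t (l : ℂ)

end Date

/-- `P' = P A` (derivative in `s`) and `∂ₜ P = P B`, entrywise. -/
def SolvesLaxPair (P A B : ℝ → ℝ → Matrix (Fin 2) (Fin 2) ℂ) : Prop :=
  ∀ s t : ℝ, ∀ i j : Fin 2,
    HasDerivAt (fun x : ℝ => P x t i j) ((P s t * A s t) i j) s ∧
    HasDerivAt (fun y : ℝ => P s y i j) ((P s t * B s t) i j) t

/-- `q` is a smooth solution of the Pohlmeyer-Lund-Regge equation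
`∂ₛ∂ₜ q + (1/2) q ∫ˢ ∂ₜ|q|² ds = 0`, where `h` is the chosen antiderivative `∫ˢ ∂ₜ|q|² ds`. -/
def IsPLRSolution (q : ℝ → ℝ → ℂ) (h : ℝ → ℝ → ℝ) : Prop :=
  ContDiff ℝ ∞ (fun p : ℝ × ℝ => q p.1 p.2) ∧
  (∀ s t : ℝ, HasDerivAt (fun x : ℝ => h x t) (deriv (fun y : ℝ => ‖q s y‖ ^ 2) t) s) ∧
  ∀ s t : ℝ, deriv (fun x : ℝ => deriv (fun y : ℝ => q x y) t) s
    + 1 / 2 * q s t * (h s t : ℂ) = 0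

/-- The `s`-coefficient of the Lax pair of the Pohlmeyer-Lund-Regge equation. -/
def laxL (q : ℝ → ℝ → ℂ) (l s t : ℝ) : Matrix (Fin 2) (Fin 2) ℂ :=
  (1 / 2 : ℂ) • !![Complex.I * (l : ℂ), q s t; -conj (q s t), -(Complex.I * (l : ℂ))]

/-- The `t`-coefficient of the Lax pair of the Pohlmeyer-Lund-Regge equation. The equation says
that `-Re (∂ₛ∂ₜ q / q) = h / 2` wherever `q ≠ 0`; the right-hand side makes sense everywhere. -/
def laxM (q : ℝ → ℝ → ℂ) (h : ℝ → ℝ → ℝ) (l s t : ℝ) : Matrix (Fin 2) (Fin 2) ℂ :=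
  (Complex.I / (2 * (l : ℂ))) •
    !![(h s t : ℂ) / 2, -deriv (fun y : ℝ => q s y) t;
      -conj (deriv (fun y : ℝ => q s y) t), -((h s t : ℂ) / 2)]

/-- The identification of `ℝ³` with `𝔰𝔲(2)`. -/
def su2OfR3 (v : Fin 3 → ℝ) : Matrix (Fin 2) (Fin 2) ℂ :=
  (1 / 2 : ℂ) • !![Complex.I * (v 2 : ℂ), -(v 0 : ℂ) - Complex.I * (v 1 : ℂ);
    (v 0 : ℂ) - Complex.I * (v 1 : ℂ), -(Complex.I * (v 2 : ℂ))]

/-- The inverse on `𝔰𝔲(2)` of the identification `su2OfR3`. -/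
def r3OfSu2 (X : Matrix (Fin 2) (Fin 2) ℂ) : Fin 3 → ℝ :=
  ![2 * (X 1 0).re, -2 * (X 1 0).im, 2 * (X 0 0).im]

/-- The Sym formula `λ (∂_λ F) F⁻¹` at `λ = 1`. -/
def symFormula (F : ℝ → ℝ → ℝ → Matrix (Fin 2) (Fin 2) ℂ) (s t : ℝ) :
    Matrix (Fin 2) (Fin 2) ℂ :=
  (Matrix.of fun i j => deriv (fun l : ℝ => F s t l i j) 1) * (F s t 1)⁻¹

/-- The `N`-soliton curve `γ`: the Sym formula for the normalized Date wave function, read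
in `ℝ³`. -/
def solitonCurve {N : ℕ} (α c : Fin N → ℂ) (s t : ℝ) : Fin 3 → ℝ :=
  r3OfSu2 (symFormula (frame α c) s t)

/-- `γ` is a (smooth) Lund-Regge evolution, `∂ₜ γ' = γ' × ∂ₜ γ`. -/
def IsLundReggeEvolution (γ : ℝ → ℝ → Fin 3 → ℝ) : Prop :=
  ContDiff ℝ ∞ (fun p : ℝ × ℝ => γ p.1 p.2) ∧
  ∀ s t : ℝ, deriv (fun y : ℝ => deriv (fun x : ℝ => γ x y) s) t =
    crossProduct (deriv (fun x : ℝ => γ x t) s) (deriv (fun y : ℝ => γ s y) t)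

/-- `γ` has unit speed in `s` for the Euclidean norm. -/
def HasUnitSpeed (γ : ℝ → ℝ → Fin 3 → ℝ) : Prop :=
  ∀ s t : ℝ, ‖WithLp.toLp 2 (deriv (fun x : ℝ => γ x t) s)‖ = 1

end LundRegge

end

namespace LundRegge

open Polynomial

/-! ### The exponential -/

/-! Write `Ψ₁₁ = p e` and `Ψ₂₁ = -q e⁻¹`, with `p` monic of degree `N` and `deg q < N` in `λ`.
Date's linear system says that `(p, q)` satisfies one linear condition at each of the `2N` nodes
`α_j`, `conj α_j`. The pairs satisfying these conditions form a `ℂ[λ]`-module that is stable under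
`(p, q) ↦ (q*, -p*)`, where `*` conjugates coefficients. Both pairs solve the same nonzero linear
equation at each node, so `p p* + q q*` vanishes there, while on the real line it equals `|p|² +
|q|²`. Hence a solution with both degrees below `N` is zero (`eq_zero_of_mem_interpModule`), which
gives `d₀ ≠ 0`. For Date's pair, `p p* + q q*` is the nodal polynomial (`hermPoly_eq_prod`); for
real `λ` this is `det Ψ`, which is therefore positive and independent of `s` and `t`.

The Lax pair is a consequence of uniqueness. Differentiating the conditions in `s` or `t` produces
another solution; subtracting suitable multiples of `(p, q)` and `(q*, -p*)` brings the degrees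
below `N`, so nothing remains (`coeffPoly_deriv_fst`, `coeffPoly_deriv_snd`). The
Pohlmeyer-Lund-Regge equation is read off from these evolutions: the leading coefficients give `∂ₜ
q`, and the constant terms give its `s`-derivative.

For the geometry, let `L`, `M` be the Lax coefficients of the `SU(2)` frame `F`. Symmetry of mixed
derivatives turns the Sym formula into `γ' = F (∂_λ L) F⁻¹` and `∂ₜ γ = F (∂_λ M) F⁻¹` at `λ = 1`.
There `∂_λ L` is a constant unit vector of `𝔰𝔲(2)` and `∂_λ M = -M`, so the evolution equation is an
identity between commutators. The explicit formula is the product rule; the normalization of `Ψ`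
contributes only a real multiple of the identity, which the coordinates of `ℝ³` do not see. -/

theorem expFun_ne_zero (s t : ℝ) (l : ℂ) : expFun s t l ≠ 0 := Complex.exp_ne_zero _

theorem expFun_neg (s t : ℝ) (l : ℂ) : expFun s t (-l) = (expFun s t l)⁻¹ := by
  rw [expFun, expFun, ← Complex.exp_neg]
  congr 1
  rw [inv_neg]
  ring

theorem conj_expFun (s t : ℝ) (l : ℂ) : conj (expFun s t l) = (expFun s t (conj l))⁻¹ := by
  rw [expFun, expFun, ← Complex.exp_neg, ← Complex.exp_conj]
  congr 1
  simp only [map_mul, map_add, map_div₀, Complex.conj_I, Complex.conj_ofReal, map_inv₀,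
    map_ofNat]
  ring

/-! ### Polynomials with prescribed coefficients -/

/-- The polynomial of degree less than `N` with coefficients `v`. -/
noncomputable def coeffPoly {N : ℕ} (v : Fin N → ℂ) : ℂ[X] := ∑ j : Fin N, C (v j) * X ^ (j : ℕ)

theorem coeffPoly_coeff {N : ℕ} (v : Fin N → ℂ) (n : ℕ) :
    (coeffPoly v).coeff n = if h : n < N then v ⟨n, h⟩ else 0 := by
  rw [coeffPoly, finsetSum_coeff]
  simp only [coeff_C_mul_X_pow]
  split_ifs with h
  · rw [Finset.sum_eq_single ⟨n, h⟩]
    · simp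
    · intro b _ hb
      rw [if_neg]
      rintro rfl
      exact hb rfl
    · simp
  · refine Finset.sum_eq_zero fun b _ => if_neg ?_
    have := b.2
    omega

theorem coeffPoly_degree_lt {N : ℕ} (v : Fin N → ℂ) : (coeffPoly v).degree < N := by
  rw [degree_lt_iff_coeff_zero]
  intro m hm
  rw [coeffPoly_coeff, dif_neg (by omega)]

theorem eval_coeffPoly {N : ℕ} (v : Fin N → ℂ) (z : ℂ) :
    (coeffPoly v).eval z = ∑ j : Fin N, v j * z ^ (j : ℕ) := by
  simp [coeffPoly, eval_finsetSum]

theorem eval_map_conj (p : ℂ[X]) (z : ℂ) :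
    (p.map (starRingEnd ℂ)).eval z = conj (p.eval (conj z)) := by
  have := eval_map_apply (f := starRingEnd ℂ) (p := p) (conj z)
  rw [Complex.conj_conj] at this
  exact this

theorem hasDerivAt_eval_coeffPoly {N : ℕ} {v : ℝ → Fin N → ℂ} {v' : Fin N → ℂ} {x : ℝ}
    (h : ∀ j, HasDerivAt (fun y => v y j) (v' j) x) (z : ℂ) :
    HasDerivAt (fun y => (coeffPoly (v y)).eval z) ((coeffPoly v').eval z) x := by
  simp only [eval_coeffPoly]
  exact HasDerivAt.fun_sum fun j _ => (h j).mul_const _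

/-! ### The interpolation conditions -/

section Interpolation

variable {N : ℕ} (α c : Fin N → ℂ)

/-- The interpolation nodes `α_j` and `conj α_j`. -/
noncomputable def node : Fin N ⊕ Fin N → ℂ := Sum.elim α fun j => conj (α j)

/-- The weights of the first polynomial in the interpolation conditions. -/
noncomputable def weightLeft : Fin N ⊕ Fin N → ℂ := Sum.elim (fun _ => 1) fun j => conj (c j)

/-- The weights of the second polynomial in the interpolation conditions. -/
noncomputable def weightRight : Fin N ⊕ Fin N → ℂ := Sum.elim (fun j => -c j) fun _ => 1

/-- The pairs of polynomials that satisfy the interpolation conditions of Date's construction. -/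
noncomputable def interpModule (s t : ℝ) : Submodule ℂ[X] (ℂ[X] × ℂ[X]) where
  carrier := {p | ∀ i, weightLeft c i * expFun s t (node α i) * p.1.eval (node α i) +
    weightRight c i * (expFun s t (node α i))⁻¹ * p.2.eval (node α i) = 0}
  zero_mem' := by intro i; simp
  add_mem' := by
    intro p q hp hq i
    simp only [Prod.fst_add, Prod.snd_add, eval_add]
    linear_combination hp i + hq i
  smul_mem' := by
    intro r p hp i
    simp only [Prod.smul_fst, Prod.smul_snd, smul_eq_mul, eval_mul]
    linear_combination r.eval (node α i) * hp i

variable {α c}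

theorem mem_interpModule {s t : ℝ} {p q : ℂ[X]} : (p, q) ∈ interpModule α c s t ↔
    ∀ i, weightLeft c i * expFun s t (node α i) * p.eval (node α i) +
      weightRight c i * (expFun s t (node α i))⁻¹ * q.eval (node α i) = 0 := Iff.rfl

/-- Conjugation exchanges the nodes `α_j` and `conj α_j` and turns `e(z)` into `e(conj z)⁻¹`. The
condition at one of these two nodes thus becomes the condition on the starred pair at the other. -/
theorem interpModule_star {s t : ℝ} {p q : ℂ[X]} (h : (p, q) ∈ interpModule α c s t) :
    (q.map (starRingEnd ℂ), -p.map (starRingEnd ℂ)) ∈ interpModule α c s t := by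
  rw [mem_interpModule] at h ⊢
  rintro (j | j)
  · have := congrArg conj (h (.inr j))
    simp only [node, weightLeft, weightRight, Sum.elim_inr, map_add, map_mul, conj_expFun,
      Complex.conj_conj, map_inv₀, inv_inv, map_one, map_zero] at this
    simp only [node, weightLeft, weightRight, Sum.elim_inl, eval_neg, eval_map_conj]
    linear_combination this
  · have := congrArg conj (h (.inl j))
    simp only [node, weightLeft, weightRight, Sum.elim_inl, map_add, map_mul, conj_expFun,
      map_inv₀, inv_inv, map_one, map_zero, map_neg] at this
    simp only [node, weightLeft, weightRight, Sum.elim_inr, eval_neg, eval_map_conj,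
      Complex.conj_conj]
    linear_combination -this

/-- The polynomial `p p* + q q*`. -/
noncomputable def hermPoly (p q : ℂ[X]) : ℂ[X] :=
  p * p.map (starRingEnd ℂ) + q * q.map (starRingEnd ℂ)

theorem eval_hermPoly_ofReal (p q : ℂ[X]) (x : ℝ) :
    (hermPoly p q).eval (x : ℂ) =
      ((‖p.eval (x : ℂ)‖ ^ 2 + ‖q.eval (x : ℂ)‖ ^ 2 : ℝ) : ℂ) := by
  simp only [hermPoly, eval_add, eval_mul, eval_map_conj, Complex.conj_ofReal, Complex.mul_conj']
  push_cast
  rfl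

/-- The vectors `(p, q)` and `(q*, -p*)` are annihilated by the same row at each node. The row is
nonzero, since one of its weights is `1` and the exponential never vanishes, so the determinant of
the two vectors is zero. -/
theorem hermPoly_eval_node {s t : ℝ} {p q : ℂ[X]} (h : (p, q) ∈ interpModule α c s t)
    (i : Fin N ⊕ Fin N) : (hermPoly p q).eval (node α i) = 0 := by
  have h1 := mem_interpModule.1 h i
  have h2 := mem_interpModule.1 (interpModule_star h) i
  have he := expFun_ne_zero s t (node α i)
  rw [eval_neg] at h2
  rw [hermPoly, eval_add, eval_mul, eval_mul]
  rcases i with j | j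
  · simp only [weightLeft, Sum.elim_inl, one_mul] at h1 h2
    refine (mul_eq_zero.1 ?_).resolve_left he
    linear_combination h1 * (p.map (starRingEnd ℂ)).eval (node α (.inl j)) +
      h2 * q.eval (node α (.inl j))
  · simp only [weightRight, Sum.elim_inr, one_mul] at h1 h2
    refine (mul_eq_zero.1 ?_).resolve_left (inv_ne_zero he)
    linear_combination h1 * (q.map (starRingEnd ℂ)).eval (node α (.inr j)) -
      h2 * p.eval (node α (.inr j))

/-- The common sign of the imaginary parts keeps the `α_j` apart from their conjugates. -/
theorem node_injective (hα : Function.Injective α)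
    (him : (∀ j, 0 < (α j).im) ∨ (∀ j, (α j).im < 0)) : Function.Injective (node α) := by
  have key : ∀ j k, α j ≠ conj (α k) := by
    intro j k h
    have := congrArg Complex.im h
    rw [Complex.conj_im] at this
    rcases him with h' | h' <;> linarith [h' j, h' k]
  rintro (j | j) (k | k) h
  · exact congrArg _ (hα h)
  · exact absurd h (key j k)
  · exact absurd h.symm (key k j)
  · exact congrArg _ (hα ((starRingEnd ℂ).injective h))

theorem node_im_ne_zero (him : (∀ j, 0 < (α j).im) ∨ (∀ j, (α j).im < 0))
    (i : Fin N ⊕ Fin N) : (node α i).im ≠ 0 := by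
  rcases i with j | j <;> rcases him with h | h <;>
    simp [node, (h j).ne, (h j).ne']

theorem node_ne_zero (him : (∀ j, 0 < (α j).im) ∨ (∀ j, (α j).im < 0))
    (i : Fin N ⊕ Fin N) : node α i ≠ 0 := fun h => node_im_ne_zero him i (by simp [h])

theorem degree_map_conj (p : ℂ[X]) : (p.map (starRingEnd ℂ)).degree = p.degree :=
  degree_map_eq_of_injective (starRingEnd ℂ).injective p

theorem degree_mul_map_conj_lt {r : ℂ[X]} (hr : r.degree < N) :
    (r * r.map (starRingEnd ℂ)).degree < (2 * N : ℕ) := by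
  rw [degree_mul, degree_map_conj]
  by_cases h0 : r = 0
  · rw [h0, degree_zero, WithBot.bot_add]
    exact WithBot.bot_lt_coe _
  · rw [degree_eq_natDegree h0] at hr ⊢
    norm_cast at hr ⊢
    omega

/-- A polynomial that vanishes at the nodes and has degree less than `2N` is zero. -/
theorem eq_zero_of_eval_node (hinj : Function.Injective (node α)) {r : ℂ[X]}
    (hr : r.degree < (2 * N : ℕ)) (h : ∀ i, r.eval (node α i) = 0) : r = 0 := by
  refine eq_zero_of_degree_lt_of_eval_index_eq_zero (s := Finset.univ)
    hinj.injOn ?_ fun i _ => h i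
  simpa [two_mul] using hr

/-- Uniqueness for the interpolation problem: a solution of degree less than `N` is zero. -/
theorem eq_zero_of_mem_interpModule (hinj : Function.Injective (node α)) {s t : ℝ}
    {p q : ℂ[X]} (h : (p, q) ∈ interpModule α c s t) (hp : p.degree < N) (hq : q.degree < N) :
    p = 0 ∧ q = 0 := by
  have hz : hermPoly p q = 0 := by
    refine eq_zero_of_eval_node hinj ?_ (hermPoly_eval_node h)
    exact (degree_add_le _ _).trans_lt (max_lt (degree_mul_map_conj_lt hp) (degree_mul_map_conj_lt hq))
  -- On the real line the vanishing polynomial is a sum of two squared moduli, so both factors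
  -- vanish at infinitely many points.
  have ev : ∀ x : ℝ, p.eval (x : ℂ) = 0 ∧ q.eval (x : ℂ) = 0 := by
    intro x
    have := eval_hermPoly_ofReal p q x
    rw [hz, eval_zero, eq_comm, Complex.ofReal_eq_zero] at this
    have h1 := sq_nonneg ‖p.eval (x : ℂ)‖
    have h2 := sq_nonneg ‖q.eval (x : ℂ)‖
    constructor <;> rw [← norm_eq_zero, ← sq_eq_zero_iff] <;> linarith
  have inf : (Set.range ((↑) : ℝ → ℂ)).Infinite :=
    Set.infinite_range_of_injective Complex.ofReal_injective
  constructor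
  · refine eq_zero_of_infinite_isRoot p (inf.mono ?_)
    rintro _ ⟨x, rfl⟩
    exact (ev x).1
  · refine eq_zero_of_infinite_isRoot q (inf.mono ?_)
    rintro _ ⟨x, rfl⟩
    exact (ev x).2

/-- For a monic solution of degree `N`, the polynomial `p p* + q q*` is the nodal polynomial. -/
theorem hermPoly_eq_prod (hinj : Function.Injective (node α)) {s t : ℝ}
    {v w : Fin N → ℂ}
    (h : (X ^ N + coeffPoly v, coeffPoly w) ∈ interpModule α c s t) :
    hermPoly (X ^ N + coeffPoly v) (coeffPoly w) = ∏ i, (X - C (node α i)) := by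
  have hm : (X ^ N + coeffPoly v).Monic := monic_X_pow_add (coeffPoly_degree_lt v)
  have hd : (X ^ N + coeffPoly v).degree = (N : WithBot ℕ) := by
    rw [degree_add_eq_left_of_degree_lt, degree_X_pow]
    rw [degree_X_pow]
    exact coeffPoly_degree_lt v
  -- The product `p p*` is monic of degree `2N` and dominates `q q*`, whose degree is smaller.
  have hm2 := hm.mul (hm.map (starRingEnd ℂ))
  have hw := degree_mul_map_conj_lt (coeffPoly_degree_lt w)
  have hd2 : ((X ^ N + coeffPoly v) * (X ^ N + coeffPoly v).map (starRingEnd ℂ)).degree =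
      ((2 * N : ℕ) : WithBot ℕ) := by
    rw [degree_mul, degree_map_conj, hd, two_mul, Nat.cast_add]
  have hmon : (hermPoly (X ^ N + coeffPoly v) (coeffPoly w)).Monic :=
    hm2.add_of_left (by rw [hd2]; exact hw)
  have hdeg : (hermPoly (X ^ N + coeffPoly v) (coeffPoly w)).degree = ((2 * N : ℕ) : WithBot ℕ) := by
    rw [hermPoly, degree_add_eq_left_of_degree_lt (by rw [hd2]; exact hw), hd2]
  have hpm : (∏ i, (X - C (node α i))).Monic := monic_prod_of_monic _ _ fun i _ => monic_X_sub_C _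
  have hpd : (∏ i, (X - C (node α i))).degree = ((2 * N : ℕ) : WithBot ℕ) := by
    rw [degree_prod]
    simp [two_mul]
  rw [← sub_eq_zero]
  -- Two monic polynomials of degree `2N` differ by one of smaller degree, which `2N` zeros force to
  -- vanish.
  refine eq_zero_of_eval_node hinj ?_ fun i => ?_
  · rw [← hdeg]
    refine degree_sub_lt_left (hdeg.trans hpd.symm) hmon.ne_zero ?_
    rw [hmon.leadingCoeff, hpm.leadingCoeff]
  · rw [eval_sub, hermPoly_eval_node h, eval_prod,
      Finset.prod_eq_zero (Finset.mem_univ i) (by simp), sub_zero]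

end Interpolation

/-! ### The determinants -/

section Determinants

variable {N : ℕ} (α c : Fin N → ℂ)

theorem coeffMatrix_inl (s t : ℝ) (i : Fin N ⊕ Fin N) (k : Fin N) :
    coeffMatrix α c s t i (.inl k) =
      weightLeft c i * expFun s t (node α i) * node α i ^ (k : ℕ) := by
  rcases i with j | j
  · simp [coeffMatrix, blockEA, node, weightLeft, Matrix.diagonal_mul, Matrix.vandermonde_apply]
  · simp [coeffMatrix, blockCEA, node, weightLeft, Matrix.diagonal_mul, Matrix.vandermonde_apply,
      conj_expFun]

theorem coeffMatrix_inr (s t : ℝ) (i : Fin N ⊕ Fin N) (k : Fin N) :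
    coeffMatrix α c s t i (.inr k) =
      weightRight c i * (expFun s t (node α i))⁻¹ * node α i ^ (k : ℕ) := by
  rcases i with j | j
  · simp [coeffMatrix, blockCEA, node, weightRight, Matrix.diagonal_mul, Matrix.vandermonde_apply]
  · simp [coeffMatrix, blockEA, node, weightRight, Matrix.diagonal_mul, Matrix.vandermonde_apply,
      conj_expFun]

theorem rhsVec_eq (s t : ℝ) (i : Fin N ⊕ Fin N) :
    rhsVec α c s t i = -(weightLeft c i * expFun s t (node α i) * node α i ^ N) := by
  rcases i with j | j <;> simp [rhsVec, weightLeft, node] <;> ring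

theorem mulVec_coeffMatrix (s t : ℝ) (v w : Fin N → ℂ) (i : Fin N ⊕ Fin N) :
    (coeffMatrix α c s t).mulVec (Sum.elim v w) i =
      weightLeft c i * expFun s t (node α i) * (coeffPoly v).eval (node α i) +
        weightRight c i * (expFun s t (node α i))⁻¹ * (coeffPoly w).eval (node α i) := by
  simp only [Matrix.mulVec, dotProduct, Fintype.sum_sum_type, coeffMatrix_inl, coeffMatrix_inr,
    Sum.elim_inl, Sum.elim_inr, eval_coeffPoly, Finset.mul_sum]
  congr 1 <;> exact Finset.sum_congr rfl fun _ _ => by ring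

theorem colNumber_injective : Function.Injective (colNumber (N := N)) := by
  rintro (j | j) (k | k) h <;> simp only [colNumber, Sum.elim_inl, Sum.elim_inr] at h <;>
    have := j.2 <;> have := k.2
  · exact congrArg _ (Fin.ext (by omega))
  · omega
  · omega
  · exact congrArg _ (Fin.ext (by omega))

theorem d_colNumber (s t : ℝ) (k : Fin N ⊕ Fin N) :
    d α c (colNumber k) s t = (coeffMatrix α c s t).cramer (rhsVec α c s t) k := by
  rw [d, Matrix.cramer_apply]
  congr 1
  ext i j
  simp only [cramerMatrix, Matrix.of_apply, Matrix.updateCol_apply, colNumber_injective.eq_iff]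

theorem d_zero (s t : ℝ) : d α c 0 s t = (coeffMatrix α c s t).det := by
  rw [d]
  congr 1
  ext i j
  rw [cramerMatrix, Matrix.of_apply, if_neg]
  rcases j with j | j <;> simp [colNumber]

/-- Conjugating `T₀` and exchanging both its block rows and its block columns gives `J T₀ J` with `J
= diag(1, -1)`, and `(det J)² = 1`. -/
theorem conj_d_zero (s t : ℝ) : conj (d α c 0 s t) = d α c 0 s t := by
  rw [d_zero, RingHom.map_det, ← Matrix.det_submatrix_equiv_self (Equiv.sumComm _ _)]
  have h := Matrix.det_mul (Matrix.fromBlocks (1 : Matrix (Fin N) (Fin N) ℂ) 0 0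
    (-1 : Matrix (Fin N) (Fin N) ℂ)) (coeffMatrix α c s t)
  have h' := Matrix.det_mul (Matrix.fromBlocks (1 : Matrix (Fin N) (Fin N) ℂ) 0 0
    (-1 : Matrix (Fin N) (Fin N) ℂ) * coeffMatrix α c s t) (Matrix.fromBlocks
      (1 : Matrix (Fin N) (Fin N) ℂ) 0 0 (-1 : Matrix (Fin N) (Fin N) ℂ))
  have hs : (Matrix.fromBlocks (1 : Matrix (Fin N) (Fin N) ℂ) 0 0
    (-1 : Matrix (Fin N) (Fin N) ℂ)).det * (Matrix.fromBlocks (1 : Matrix (Fin N) (Fin N) ℂ) 0 0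
    (-1 : Matrix (Fin N) (Fin N) ℂ)).det = 1 := by
    rw [← Matrix.det_mul, Matrix.fromBlocks_multiply]
    simp
  rw [h] at h'
  have e : (Matrix.fromBlocks (1 : Matrix (Fin N) (Fin N) ℂ) 0 0
    (-1 : Matrix (Fin N) (Fin N) ℂ) * coeffMatrix α c s t) * (Matrix.fromBlocks
      (1 : Matrix (Fin N) (Fin N) ℂ) 0 0 (-1 : Matrix (Fin N) (Fin N) ℂ)) =
      ((starRingEnd ℂ).mapMatrix (coeffMatrix α c s t)).submatrix (Equiv.sumComm _ _)
        (Equiv.sumComm _ _) := by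
    rw [coeffMatrix, Matrix.fromBlocks_multiply, Matrix.fromBlocks_multiply]
    ext (i | i) (j | j) <;> simp
  rw [← e, h']
  linear_combination (coeffMatrix α c s t).det * hs

/-- The coefficients `d_{j+1} / d₀`. -/
noncomputable def coeffLeft (s t : ℝ) (j : Fin N) : ℂ := d α c ((j : ℕ) + 1) s t / d α c 0 s t

/-- The coefficients `d_{N+j+1} / d₀`. -/
noncomputable def coeffRight (s t : ℝ) (j : Fin N) : ℂ :=
  d α c (N + (j : ℕ) + 1) s t / d α c 0 s t

/-- The polynomial factor of `Ψ₁₁`. -/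
noncomputable def polyLeft (s t : ℝ) : ℂ[X] := X ^ N + coeffPoly (coeffLeft α c s t)

/-- The polynomial factor of `-Ψ₂₁`. -/
noncomputable def polyRight (s t : ℝ) : ℂ[X] := coeffPoly (coeffRight α c s t)

variable {α c}

/-- A kernel vector of `T₀` is the coefficient vector of a solution with both degrees below `N`,
which uniqueness forces to be zero. -/
theorem d_zero_ne_zero (hinj : Function.Injective (node α)) (s t : ℝ) :
    d α c 0 s t ≠ 0 := by
  rw [d_zero]
  intro h
  obtain ⟨v, hv, h0⟩ := Matrix.exists_mulVec_eq_zero_iff.2 h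
  have hm : (coeffPoly (fun j => v (.inl j)), coeffPoly (fun j => v (.inr j))) ∈
      interpModule α c s t := by
    rw [mem_interpModule]
    intro i
    rw [← mulVec_coeffMatrix]
    have : Sum.elim (fun j => v (.inl j)) (fun j => v (.inr j)) = v := by
      ext (j | j) <;> rfl
    rw [this, h0]
    rfl
  obtain ⟨h1, h2⟩ := eq_zero_of_mem_interpModule hinj hm (coeffPoly_degree_lt _)
    (coeffPoly_degree_lt _)
  apply hv
  ext (j | j)
  · simpa [coeffPoly_coeff] using congrArg (fun p => p.coeff j) h1
  · simpa [coeffPoly_coeff] using congrArg (fun p => p.coeff j) h2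

/-- This is Cramer's rule: the quotients `d_k / d₀` solve `T₀ ψ = b`, and moving `b` to the left
supplies the leading term `λ^N` of the first polynomial. -/
theorem polyLeft_polyRight_mem (hinj : Function.Injective (node α)) (s t : ℝ) :
    (polyLeft α c s t, polyRight α c s t) ∈ interpModule α c s t := by
  rw [mem_interpModule]
  intro i
  have h := Matrix.mulVec_cramer (coeffMatrix α c s t) (rhsVec α c s t)
  have h0 := d_zero_ne_zero (c := c) hinj s t
  have hx : (coeffMatrix α c s t).cramer (rhsVec α c s t) =
      d α c 0 s t • Sum.elim (coeffLeft α c s t) (coeffRight α c s t) := by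
    ext (j | j) <;> rw [← d_colNumber] <;>
      simp [colNumber, coeffLeft, coeffRight, mul_div_cancel₀ _ h0]
  rw [hx, Matrix.mulVec_smul, ← d_zero] at h
  have h1 := congrFun (smul_right_injective _ h0 h) i
  rw [mulVec_coeffMatrix, rhsVec_eq] at h1
  rw [polyLeft, polyRight, eval_add, eval_pow, eval_X]
  linear_combination h1

theorem hermPoly_polyLeft_polyRight (hinj : Function.Injective (node α)) (s t : ℝ) :
    hermPoly (polyLeft α c s t) (polyRight α c s t) = ∏ i, (X - C (node α i)) :=
  hermPoly_eq_prod hinj (polyLeft_polyRight_mem hinj s t)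

end Determinants

end LundRegge

namespace LundRegge

open Polynomial

/-! ### Smoothness of the determinants -/

section Smooth

variable {N : ℕ} {α c : Fin N → ℂ}

theorem contDiff_expFun (l : ℂ) : ContDiff ℝ ∞ fun p : ℝ × ℝ => expFun p.1 p.2 l := by
  unfold expFun
  refine ContDiff.cexp (contDiff_const.mul ((contDiff_const.mul ?_).add (contDiff_const.mul ?_)))
  · exact Complex.ofRealCLM.contDiff.comp contDiff_fst
  · exact Complex.ofRealCLM.contDiff.comp contDiff_snd

theorem contDiff_d (k : ℕ) : ContDiff ℝ ∞ fun p : ℝ × ℝ => d α c k p.1 p.2 := by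
  simp only [d, Matrix.det_apply']
  refine ContDiff.sum fun σ _ => contDiff_const.mul (contDiff_prod fun i _ => ?_)
  simp only [cramerMatrix, Matrix.of_apply]
  split_ifs
  · simp only [rhsVec_eq]
    exact ((contDiff_const.mul (contDiff_expFun _)).mul contDiff_const).neg
  · rcases i with j | j
    · simp only [coeffMatrix_inl]
      exact (contDiff_const.mul (contDiff_expFun _)).mul contDiff_const
    · simp only [coeffMatrix_inr]
      exact (contDiff_const.mul ((contDiff_expFun _).inv fun p => expFun_ne_zero _ _ _)).mul
        contDiff_const

theorem contDiff_d_div (hinj : Function.Injective (node α)) (k : ℕ) :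
    ContDiff ℝ ∞ fun p : ℝ × ℝ => d α c k p.1 p.2 / d α c 0 p.1 p.2 := by
  simp only [div_eq_mul_inv]
  exact (contDiff_d (α := α) (c := c) k).mul
    (ContDiff.inv (contDiff_d (α := α) (c := c) 0) fun p => d_zero_ne_zero hinj p.1 p.2)

theorem _root_.ContDiff.hasDerivAt_fst {E : Type*} [NormedAddCommGroup E] [NormedSpace ℝ E]
    {G : ℝ × ℝ → E} (hG : ContDiff ℝ ∞ G) (s t : ℝ) :
    HasDerivAt (fun x => G (x, t)) (deriv (fun x => G (x, t)) s) s :=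
  ((hG.comp (contDiff_prodMk_left t)).differentiable (by simp) s).hasDerivAt

theorem _root_.ContDiff.hasDerivAt_snd {E : Type*} [NormedAddCommGroup E] [NormedSpace ℝ E]
    {G : ℝ × ℝ → E} (hG : ContDiff ℝ ∞ G) (s t : ℝ) :
    HasDerivAt (fun y => G (s, y)) (deriv (fun y => G (s, y)) t) t :=
  ((hG.comp (contDiff_prodMk_right s)).differentiable (by simp) t).hasDerivAt

theorem hasDerivAt_expFun_fst (s t : ℝ) (l : ℂ) :
    HasDerivAt (fun x => expFun x t l) (Complex.I / 2 * l * expFun s t l) s := by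
  unfold expFun
  have h1 : HasDerivAt (fun x : ℝ => (x : ℂ)) 1 s := Complex.ofRealCLM.hasDerivAt
  convert (((h1.const_mul l).add_const (l⁻¹ * (t : ℂ))).const_mul (Complex.I / 2)).cexp using 1
  ring

theorem hasDerivAt_expFun_snd (s t : ℝ) (l : ℂ) :
    HasDerivAt (fun y => expFun s y l) (Complex.I / 2 * l⁻¹ * expFun s t l) t := by
  unfold expFun
  have h1 : HasDerivAt (fun x : ℝ => (x : ℂ)) 1 t := Complex.ofRealCLM.hasDerivAt
  convert (((h1.const_mul l⁻¹).const_add (l * (s : ℂ))).const_mul (Complex.I / 2)).cexp using 1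
  ring

end Smooth

/-! ### The evolution of the polynomial factors -/

section Evolution

variable {N : ℕ} {α c : Fin N → ℂ}

/-- The conditions hold identically along the curve `(S, T)`, so their derivative vanishes. Here `κ`
is the logarithmic derivative of `e`, namely `iz/2` in `s` and `i/(2z)` in `t`; its two signs come
from `e` and `e⁻¹`. The general curve covers both variables at once. -/
theorem interp_deriv (hinj : Function.Injective (node α)) {S T : ℝ → ℝ} {x : ℝ} {κ : ℂ → ℂ}
    {v w : Fin N → ℂ}
    (hκ : ∀ z, HasDerivAt (fun y => expFun (S y) (T y) z) (κ z * expFun (S x) (T x) z) x)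
    (hv : ∀ j, HasDerivAt (fun y => coeffLeft α c (S y) (T y) j) (v j) x)
    (hw : ∀ j, HasDerivAt (fun y => coeffRight α c (S y) (T y) j) (w j) x)
    (i : Fin N ⊕ Fin N) :
    weightLeft c i * expFun (S x) (T x) (node α i) *
        (κ (node α i) * (polyLeft α c (S x) (T x)).eval (node α i) +
          (coeffPoly v).eval (node α i)) +
      weightRight c i * (expFun (S x) (T x) (node α i))⁻¹ *
        (-κ (node α i) * (polyRight α c (S x) (T x)).eval (node α i) +
          (coeffPoly w).eval (node α i)) = 0 := by
  set z := node α i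
  have he := expFun_ne_zero (S x) (T x) z
  have hP : HasDerivAt (fun y => (polyLeft α c (S y) (T y)).eval z) ((coeffPoly v).eval z) x := by
    simp only [polyLeft, eval_add]
    exact (hasDerivAt_eval_coeffPoly hv z).const_add _
  have hY : HasDerivAt (fun y => (polyRight α c (S y) (T y)).eval z) ((coeffPoly w).eval z) x :=
    hasDerivAt_eval_coeffPoly hw z
  have h := (((hκ z).const_mul (weightLeft c i)).fun_mul hP).fun_add
    ((((hκ z).fun_inv he).const_mul (weightRight c i)).fun_mul hY)
  have h0 : (fun y => weightLeft c i * expFun (S y) (T y) z * (polyLeft α c (S y) (T y)).eval z +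
      weightRight c i * (expFun (S y) (T y) z)⁻¹ * (polyRight α c (S y) (T y)).eval z) =
      fun _ => 0 :=
    funext fun y => mem_interpModule.1 (polyLeft_polyRight_mem hinj (S y) (T y)) i
  rw [h0] at h
  have h1 := h.unique (hasDerivAt_const x 0)
  rw [← h1]
  field_simp

theorem polyLeft_coeff_self (s t : ℝ) : (polyLeft α c s t).coeff N = 1 := by
  simp [polyLeft, coeffPoly_coeff]

theorem polyLeft_coeff_of_lt (s t : ℝ) {n : ℕ} (hn : N < n) : (polyLeft α c s t).coeff n = 0 := by
  rw [polyLeft, coeff_add, coeff_X_pow, if_neg hn.ne', coeffPoly_coeff, dif_neg (by omega),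
    add_zero]

theorem polyRight_coeff_of_le (s t : ℝ) {n : ℕ} (hn : N ≤ n) : (polyRight α c s t).coeff n = 0 := by
  rw [polyRight, coeffPoly_coeff, dif_neg (by omega)]

theorem polyLeft_coeff_zero (hN : 0 < N) (s t : ℝ) :
    (polyLeft α c s t).coeff 0 = d α c 1 s t / d α c 0 s t := by
  rw [polyLeft, coeff_add, coeff_X_pow, if_neg hN.ne, coeffPoly_coeff, dif_pos hN, coeffLeft,
    zero_add]

theorem polyRight_coeff_zero (hN : 0 < N) (s t : ℝ) :
    (polyRight α c s t).coeff 0 = d α c (N + 1) s t / d α c 0 s t := by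
  rw [polyRight, coeffPoly_coeff, dif_pos hN, coeffRight]
  rfl

theorem polyRight_coeff_pred (hN : 0 < N) (s t : ℝ) :
    (polyRight α c s t).coeff (N - 1) = d α c (2 * N) s t / d α c 0 s t := by
  rw [polyRight, coeffPoly_coeff, dif_pos (by omega), coeffRight]
  congr 2
  simp only
  omega

/-- This is the nodal identity at `λ = 0`. It makes the denominator of the `t`-part of the Lax pair
a constant in `s` and `t`, nonzero as soon as no node is zero. -/
theorem norm_sq_coeff_zero (hinj : Function.Injective (node α)) (s t : ℝ) :
    ((‖(polyLeft α c s t).coeff 0‖ ^ 2 + ‖(polyRight α c s t).coeff 0‖ ^ 2 : ℝ) : ℂ) =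
      ∏ i, -node α i := by
  have h := eval_hermPoly_ofReal (polyLeft α c s t) (polyRight α c s t) 0
  simp only [Complex.ofReal_zero, ← coeff_zero_eq_eval_zero] at h
  rw [← h, hermPoly_polyLeft_polyRight hinj, coeff_zero_eq_eval_zero, eval_prod]
  simp

/-- Removing `(iλ/2)(p, q)` from the differentiated pair leaves `(p', q' - iλq)`. Its only
coefficient of degree `N` is `-i q_{N-1}`, in the second entry; removing `i q_{N-1} (q*, -p*)`
cancels it because `p*` is monic, and uniqueness applies. -/
theorem coeffPoly_deriv_fst (hN : 0 < N) (hinj : Function.Injective (node α)) (s t : ℝ)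
    {v w : Fin N → ℂ}
    (hv : ∀ j, HasDerivAt (fun x => coeffLeft α c x t j) (v j) s)
    (hw : ∀ j, HasDerivAt (fun x => coeffRight α c x t j) (w j) s) :
    coeffPoly v = C (Complex.I * (polyRight α c s t).coeff (N - 1)) *
        (polyRight α c s t).map (starRingEnd ℂ) ∧
      coeffPoly w = C Complex.I * (X * polyRight α c s t) -
        C (Complex.I * (polyRight α c s t).coeff (N - 1)) *
          (polyLeft α c s t).map (starRingEnd ℂ) := by
  rw [← sub_eq_zero, ← sub_eq_zero (b := C Complex.I * (X * polyRight α c s t) - _)]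
  refine eq_zero_of_mem_interpModule (s := s) (t := t) (c := c) hinj ?_ ?_ ?_
  · rw [mem_interpModule]
    intro i
    have h1 := interp_deriv (S := id) (T := fun _ => t) hinj
      (fun z => hasDerivAt_expFun_fst s t z) hv hw i
    have h2 := mem_interpModule.1 (polyLeft_polyRight_mem (c := c) hinj s t) i
    have h3 := mem_interpModule.1 (interpModule_star (polyLeft_polyRight_mem (c := c) hinj s t)) i
    simp only [id, eval_neg, eval_sub, eval_mul, eval_C, eval_X] at h1 h2 h3 ⊢
    linear_combination h1 - Complex.I / 2 * node α i * h2 -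
      Complex.I * (polyRight α c s t).coeff (N - 1) * h3
  · rw [degree_lt_iff_coeff_zero]
    intro n hn
    rw [coeff_sub, coeff_C_mul, coeff_map, polyRight_coeff_of_le s t hn, coeffPoly_coeff,
      dif_neg (by omega)]
    simp
  · rw [degree_lt_iff_coeff_zero]
    intro n hn
    obtain ⟨n, rfl⟩ : ∃ k, n = k + 1 := ⟨n - 1, by omega⟩
    rw [coeff_sub, coeff_sub, coeff_C_mul, coeff_C_mul, coeff_map, coeff_X_mul, coeffPoly_coeff,
      dif_neg (by omega)]
    -- Degree `N` is the only place where a cancellation is needed; above it every term vanishes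
    -- separately.
    rcases hn.eq_or_lt with h | h
    · have h' : N - 1 = n := by omega
      rw [← h, h', polyLeft_coeff_self]
      simp
    · rw [polyLeft_coeff_of_lt s t h, polyRight_coeff_of_le s t (by omega)]
      simp

/-- The diagonal coefficient of the `t`-part of the Lax pair. -/
noncomputable def diagCoeff (α c : Fin N → ℂ) (s t : ℝ) : ℝ :=
  (‖(polyLeft α c s t).coeff 0‖ ^ 2 - ‖(polyRight α c s t).coeff 0‖ ^ 2) /
    (‖(polyLeft α c s t).coeff 0‖ ^ 2 + ‖(polyRight α c s t).coeff 0‖ ^ 2)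

/-- The off-diagonal coefficient of the `t`-part of the Lax pair. -/
noncomputable def offDiagCoeff (α c : Fin N → ℂ) (s t : ℝ) : ℂ :=
  (polyLeft α c s t).coeff 0 * (polyRight α c s t).coeff 0 /
    ((‖(polyLeft α c s t).coeff 0‖ ^ 2 + ‖(polyRight α c s t).coeff 0‖ ^ 2 : ℝ) : ℂ)

theorem divX_eq {p : ℂ[X]} (hp : p.coeff 0 = 0) (z : ℂ) : z * p.divX.eval z = p.eval z := by
  conv_rhs => rw [← divX_mul_X_add p, hp]
  simp [mul_comm]

theorem coeffPoly_deriv_snd (hinj : Function.Injective (node α))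
    (h0 : ∀ i, node α i ≠ 0) (s t : ℝ) {v w : Fin N → ℂ}
    (hv : ∀ j, HasDerivAt (fun y => coeffLeft α c s y j) (v j) t)
    (hw : ∀ j, HasDerivAt (fun y => coeffRight α c s y j) (w j) t) :
    X * coeffPoly v = C (Complex.I / 2) * (C ((diagCoeff α c s t : ℂ) - 1) * polyLeft α c s t +
        C (2 * offDiagCoeff α c s t) * (polyRight α c s t).map (starRingEnd ℂ)) ∧
      X * coeffPoly w = C (Complex.I / 2) * (C ((diagCoeff α c s t : ℂ) + 1) * polyRight α c s t -
        C (2 * offDiagCoeff α c s t) * (polyLeft α c s t).map (starRingEnd ℂ)) := by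
  set a := C (Complex.I / 2) * (C ((diagCoeff α c s t : ℂ) - 1) * polyLeft α c s t +
        C (2 * offDiagCoeff α c s t) * (polyRight α c s t).map (starRingEnd ℂ)) with ha
  set b := C (Complex.I / 2) * (C ((diagCoeff α c s t : ℂ) + 1) * polyRight α c s t -
        C (2 * offDiagCoeff α c s t) * (polyLeft α c s t).map (starRingEnd ℂ)) with hb
  have hD := norm_sq_coeff_zero (c := c) hinj s t
  have hD0 : ∏ i, -node α i ≠ 0 := Finset.prod_ne_zero_iff.2 fun i _ => neg_ne_zero.2 (h0 i)
  rw [← hD] at hD0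
  push_cast at hD0
  -- The values of `diagCoeff` and `offDiagCoeff` are those for which both right-hand sides vanish
  -- at `λ = 0`, so that division by `λ` is possible.
  have ha0 : a.coeff 0 = 0 := by
    rw [ha, coeff_C_mul, coeff_add, coeff_C_mul, coeff_C_mul, coeff_map, diagCoeff, offDiagCoeff]
    push_cast
    rw [← Complex.mul_conj', ← Complex.mul_conj'] at hD0 ⊢
    field_simp
    ring
  have hb0 : b.coeff 0 = 0 := by
    rw [hb, coeff_C_mul, coeff_sub, coeff_C_mul, coeff_C_mul, coeff_map, diagCoeff, offDiagCoeff]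
    push_cast
    rw [← Complex.mul_conj', ← Complex.mul_conj'] at hD0 ⊢
    field_simp
    ring
  -- The right-hand sides have degree at most `N`, so their quotients by `λ` have degree below `N`
  -- and uniqueness applies.
  have key : coeffPoly v - a.divX = 0 ∧ coeffPoly w - b.divX = 0 := by
    refine eq_zero_of_mem_interpModule (s := s) (t := t) (c := c) hinj ?_ ?_ ?_
    · rw [mem_interpModule]
      intro i
      have h1 := interp_deriv (S := fun _ => s) (T := id) hinj
        (fun z => hasDerivAt_expFun_snd s t z) hv hw i
      have h2 := mem_interpModule.1 (polyLeft_polyRight_mem (c := c) hinj s t) i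
      have h3 := mem_interpModule.1
        (interpModule_star (polyLeft_polyRight_mem (c := c) hinj s t)) i
      have e1 := divX_eq ha0 (node α i)
      have e2 := divX_eq hb0 (node α i)
      have hz := mul_inv_cancel₀ (h0 i)
      simp only [ha, hb, id, eval_neg, eval_sub, eval_add, eval_mul, eval_C] at h1 h2 h3 e1 e2 ⊢
      -- Multiplication by the node clears the denominator of `κ(z) = i/(2z)`.
      refine (mul_eq_zero.1 ?_).resolve_left (h0 i)
      linear_combination node α i * h1 -
        Complex.I / 2 * diagCoeff α c s t * h2 - Complex.I * offDiagCoeff α c s t * h3 -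
        weightLeft c i * expFun s t (node α i) * e1 -
        weightRight c i * (expFun s t (node α i))⁻¹ * e2 -
        Complex.I / 2 * (weightLeft c i * expFun s t (node α i) *
            (polyLeft α c s t).eval (node α i) -
          weightRight c i * (expFun s t (node α i))⁻¹ *
            (polyRight α c s t).eval (node α i)) * hz
    · rw [degree_lt_iff_coeff_zero]
      intro n hn
      rw [coeff_sub, coeff_divX, ha, coeff_C_mul, coeff_add, coeff_C_mul, coeff_C_mul, coeff_map,
        polyRight_coeff_of_le s t (by omega), polyLeft_coeff_of_lt s t (by omega), coeffPoly_coeff,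
        dif_neg (by omega)]
      simp
    · rw [degree_lt_iff_coeff_zero]
      intro n hn
      rw [coeff_sub, coeff_divX, hb, coeff_C_mul, coeff_sub, coeff_C_mul, coeff_C_mul, coeff_map,
        polyRight_coeff_of_le s t (by omega), polyLeft_coeff_of_lt s t (by omega), coeffPoly_coeff,
        dif_neg (by omega)]
      simp
  have ea := divX_mul_X_add a
  have eb := divX_mul_X_add b
  rw [ha0, C_0, add_zero] at ea
  rw [hb0, C_0, add_zero] at eb
  rw [sub_eq_zero.1 key.1, sub_eq_zero.1 key.2]
  exact ⟨by rw [mul_comm, ea], by rw [mul_comm, eb]⟩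

end Evolution

end LundRegge

namespace LundRegge

open Polynomial

/-! ### The Lax pair of the wave function -/

section WaveFunction

variable {N : ℕ} {α c : Fin N → ℂ}

theorem Psi11_eq (s t : ℝ) (l : ℂ) :
    Psi11 α c s t l = (polyLeft α c s t).eval l * expFun s t l := by
  rw [Psi11, polyLeft, eval_add, eval_coeffPoly, eval_pow, eval_X]
  rfl

theorem Psi21_eq (s t : ℝ) (l : ℂ) :
    Psi21 α c s t l = -(polyRight α c s t).eval l * (expFun s t l)⁻¹ := by
  rw [Psi21, polyRight, eval_coeffPoly, expFun, ← Complex.exp_neg]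
  rfl

theorem Psi_eq (s t : ℝ) (l : ℂ) : Psi α c s t l =
    !![(polyLeft α c s t).eval l * expFun s t l,
        ((polyRight α c s t).map (starRingEnd ℂ)).eval l * expFun s t l;
      -(polyRight α c s t).eval l * (expFun s t l)⁻¹,
        ((polyLeft α c s t).map (starRingEnd ℂ)).eval l * (expFun s t l)⁻¹] := by
  simp only [Psi, Psi11_eq, Psi21_eq, eval_map_conj, map_mul, map_neg, map_inv₀, conj_expFun,
    Complex.conj_conj, inv_inv, neg_mul, neg_neg]

theorem dateL_eq (hN : 0 < N) (s t : ℝ) (l : ℂ) : dateL α c s t l =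
    (1 / 2 : ℂ) • !![Complex.I * l, 2 * Complex.I * conj ((polyRight α c s t).coeff (N - 1));
      2 * Complex.I * (polyRight α c s t).coeff (N - 1), -(Complex.I * l)] := by
  rw [dateL, polyRight_coeff_pred hN]

/-- The numerators and the denominator of the matrix are quadratic in `d₁`, `d_{N+1}`. Since `d₀` is
real, replacing these by their quotients by `d₀` only cancels a factor `d₀²`. -/
theorem dateM_eq (hN : 0 < N) (hinj : Function.Injective (node α)) (s t : ℝ) (l : ℂ) :
    dateM α c s t l = (Complex.I / (2 * l)) •
      !![(diagCoeff α c s t : ℂ), 2 * conj (offDiagCoeff α c s t);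
        2 * offDiagCoeff α c s t, -(diagCoeff α c s t : ℂ)] := by
  have h0 := d_zero_ne_zero (c := c) hinj s t
  have hr := conj_d_zero α c s t
  have hx : d α c 1 s t = (polyLeft α c s t).coeff 0 * d α c 0 s t := by
    rw [polyLeft_coeff_zero hN, div_mul_cancel₀ _ h0]
  have hy : d α c (N + 1) s t = (polyRight α c s t).coeff 0 * d α c 0 s t := by
    rw [polyRight_coeff_zero hN, div_mul_cancel₀ _ h0]
  obtain ⟨r, hr⟩ := Complex.conj_eq_iff_real.1 hr
  rw [hr, Complex.ofReal_ne_zero] at h0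
  rw [dateM, diagCoeff, offDiagCoeff, hx, hy, hr]
  set u := (polyLeft α c s t).coeff 0
  set w := (polyRight α c s t).coeff 0
  have hn : ∀ z : ℂ, ‖z * (r : ℂ)‖ ^ 2 = r ^ 2 * ‖z‖ ^ 2 := by
    intro z
    rw [norm_mul, mul_pow, Complex.norm_real, Real.norm_eq_abs, sq_abs, mul_comm]
  rw [hn, hn, ← mul_add, ← mul_sub]
  have h2 : (-(r ^ 2 * ‖u‖ ^ 2) + r ^ 2 * ‖w‖ ^ 2) = - (r ^ 2 * (‖u‖ ^ 2 - ‖w‖ ^ 2)) := by ring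
  rw [h2]
  have hrc : (r : ℂ) ≠ 0 := Complex.ofReal_ne_zero.2 h0
  generalize ‖u‖ ^ 2 + ‖w‖ ^ 2 = D
  generalize ‖u‖ ^ 2 - ‖w‖ ^ 2 = K
  have hI : Complex.I / (2 * l * ((r ^ 2 * D : ℝ) : ℂ)) =
      Complex.I / (2 * l) * (D : ℂ)⁻¹ * ((r : ℂ) ^ 2)⁻¹ := by
    push_cast
    rw [div_eq_mul_inv, div_eq_mul_inv, mul_inv, mul_inv]
    ring
  rw [hI]
  ext i j
  fin_cases i <;> fin_cases j <;>
    simp [div_eq_mul_inv, Complex.conj_ofReal] <;> field_simp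

theorem hasDerivAt_coeffLeft_fst (hinj : Function.Injective (node α)) (s t : ℝ) (j : Fin N) :
    HasDerivAt (fun x => coeffLeft α c x t j) (deriv (fun x => coeffLeft α c x t j) s) s :=
  (contDiff_d_div hinj _).hasDerivAt_fst s t

theorem hasDerivAt_coeffRight_fst (hinj : Function.Injective (node α)) (s t : ℝ) (j : Fin N) :
    HasDerivAt (fun x => coeffRight α c x t j) (deriv (fun x => coeffRight α c x t j) s) s :=
  (contDiff_d_div hinj _).hasDerivAt_fst s t

theorem hasDerivAt_coeffLeft_snd (hinj : Function.Injective (node α)) (s t : ℝ) (j : Fin N) :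
    HasDerivAt (fun y => coeffLeft α c s y j) (deriv (fun y => coeffLeft α c s y j) t) t :=
  (contDiff_d_div hinj _).hasDerivAt_snd s t

theorem hasDerivAt_coeffRight_snd (hinj : Function.Injective (node α)) (s t : ℝ) (j : Fin N) :
    HasDerivAt (fun y => coeffRight α c s y j) (deriv (fun y => coeffRight α c s y j) t) t :=
  (contDiff_d_div hinj _).hasDerivAt_snd s t

theorem hasDerivAt_polyLeft_fst (hN : 0 < N) (hinj : Function.Injective (node α)) (s t : ℝ)
    (z : ℂ) : HasDerivAt (fun x => (polyLeft α c x t).eval z)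
      (Complex.I * (polyRight α c s t).coeff (N - 1) *
        ((polyRight α c s t).map (starRingEnd ℂ)).eval z) s := by
  have h := hasDerivAt_eval_coeffPoly (hasDerivAt_coeffLeft_fst (c := c) hinj s t) z
  rw [(coeffPoly_deriv_fst hN hinj s t (hasDerivAt_coeffLeft_fst hinj s t)
    (hasDerivAt_coeffRight_fst hinj s t)).1, eval_mul, eval_C] at h
  simp only [polyLeft, eval_add]
  exact h.const_add _

theorem hasDerivAt_polyRight_fst (hN : 0 < N) (hinj : Function.Injective (node α)) (s t : ℝ)
    (z : ℂ) : HasDerivAt (fun x => (polyRight α c x t).eval z)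
      (Complex.I * (z * (polyRight α c s t).eval z) -
        Complex.I * (polyRight α c s t).coeff (N - 1) *
          ((polyLeft α c s t).map (starRingEnd ℂ)).eval z) s := by
  have h := hasDerivAt_eval_coeffPoly (hasDerivAt_coeffRight_fst (c := c) hinj s t) z
  rw [(coeffPoly_deriv_fst hN hinj s t (hasDerivAt_coeffLeft_fst hinj s t)
    (hasDerivAt_coeffRight_fst hinj s t)).2] at h
  simp only [eval_sub, eval_mul, eval_C, eval_X] at h
  exact h

theorem hasDerivAt_polyLeft_snd (hinj : Function.Injective (node α))
    (h0 : ∀ i, node α i ≠ 0) (s t : ℝ) {z : ℂ} (hz : z ≠ 0) :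
    HasDerivAt (fun y => (polyLeft α c s y).eval z)
      (Complex.I / 2 * z⁻¹ * (((diagCoeff α c s t : ℂ) - 1) * (polyLeft α c s t).eval z +
        2 * offDiagCoeff α c s t * ((polyRight α c s t).map (starRingEnd ℂ)).eval z)) t := by
  have h := hasDerivAt_eval_coeffPoly (hasDerivAt_coeffLeft_snd (c := c) hinj s t) z
  have e := congrArg (eval z) (coeffPoly_deriv_snd hinj h0 s t (hasDerivAt_coeffLeft_snd hinj s t)
    (hasDerivAt_coeffRight_snd (c := c) hinj s t)).1
  simp only [eval_mul, eval_add, eval_C, eval_X] at e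
  rw [mul_right_comm, ← e, mul_comm, inv_mul_cancel_left₀ hz]
  simp only [polyLeft, eval_add]
  exact h.const_add _

theorem hasDerivAt_polyRight_snd (hinj : Function.Injective (node α))
    (h0 : ∀ i, node α i ≠ 0) (s t : ℝ) {z : ℂ} (hz : z ≠ 0) :
    HasDerivAt (fun y => (polyRight α c s y).eval z)
      (Complex.I / 2 * z⁻¹ * (((diagCoeff α c s t : ℂ) + 1) * (polyRight α c s t).eval z -
        2 * offDiagCoeff α c s t * ((polyLeft α c s t).map (starRingEnd ℂ)).eval z)) t := by
  have h := hasDerivAt_eval_coeffPoly (hasDerivAt_coeffRight_snd (c := c) hinj s t) z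
  have e := congrArg (eval z) (coeffPoly_deriv_snd hinj h0 s t (hasDerivAt_coeffLeft_snd hinj s t)
    (hasDerivAt_coeffRight_snd (c := c) hinj s t)).2
  simp only [eval_mul, eval_sub, eval_C, eval_X] at e
  rw [mul_right_comm, ← e, mul_comm, inv_mul_cancel_left₀ hz]
  exact h

/-- In degree `N` the `t`-evolution of `λ q` retains only the leading coefficient `1` of `p*`. -/
theorem hasDerivAt_polyRight_coeff_pred_snd (hN : 0 < N) (hinj : Function.Injective (node α))
    (h0 : ∀ i, node α i ≠ 0) (s t : ℝ) :
    HasDerivAt (fun y => (polyRight α c s y).coeff (N - 1))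
      (-(Complex.I * offDiagCoeff α c s t)) t := by
  have h := hasDerivAt_coeffRight_snd (c := c) hinj s t ⟨N - 1, by omega⟩
  have e := congrArg (fun p => p.coeff N) (coeffPoly_deriv_snd hinj h0 s t
    (hasDerivAt_coeffLeft_snd hinj s t) (hasDerivAt_coeffRight_snd (c := c) hinj s t)).2
  obtain ⟨n, rfl⟩ : ∃ k, N = k + 1 := ⟨N - 1, by omega⟩
  simp only [coeff_X_mul, coeff_C_mul, coeff_sub, coeff_map, polyLeft_coeff_self,
    polyRight_coeff_of_le s t le_rfl, map_one] at e
  rw [coeffPoly_coeff, dif_pos (by omega)] at e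
  simp only [polyRight, coeffPoly_coeff, dif_pos (show n + 1 - 1 < n + 1 by omega)]
  convert h using 1
  refine Eq.trans ?_ e.symm
  ring

theorem hasDerivAt_eval_map_conj {p : ℝ → ℂ[X]} {p' z : ℂ} {x : ℝ}
    (h : HasDerivAt (fun y => (p y).eval (conj z)) p' x) :
    HasDerivAt (fun y => ((p y).map (starRingEnd ℂ)).eval z) (conj p') x := by
  simp only [eval_map_conj]
  exact h.star

theorem Psi_solvesLaxPair (hN : 0 < N) (hinj : Function.Injective (node α))
    (h0 : ∀ i, node α i ≠ 0) {l : ℂ} (hl : l ≠ 0) :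
    SolvesLaxPair (fun s t => Psi α c s t l) (fun s t => dateL α c s t l)
      (fun s t => dateM α c s t l) := by
  have hl' : conj l ≠ 0 := by simpa using hl
  intro s t
  have he := expFun_ne_zero s t l
  have e1 := hasDerivAt_expFun_fst s t l
  have e2 := hasDerivAt_expFun_snd s t l
  have i1 := e1.fun_inv he
  have i2 := e2.fun_inv he
  have a1 := hasDerivAt_polyLeft_fst (c := c) hN hinj s t l
  have a2 := hasDerivAt_polyLeft_snd (c := c) hinj h0 s t hl
  have b1 := hasDerivAt_polyRight_fst (c := c) hN hinj s t l
  have b2 := hasDerivAt_polyRight_snd (c := c) hinj h0 s t hl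
  have c1 := hasDerivAt_eval_map_conj (hasDerivAt_polyLeft_fst (c := c) hN hinj s t (conj l))
  have c2 := hasDerivAt_eval_map_conj (hasDerivAt_polyLeft_snd (c := c) hinj h0 s t hl')
  have d1 := hasDerivAt_eval_map_conj (hasDerivAt_polyRight_fst (c := c) hN hinj s t (conj l))
  have d2 := hasDerivAt_eval_map_conj (hasDerivAt_polyRight_snd (c := c) hinj h0 s t hl')
  simp only [dateL_eq hN, dateM_eq hN hinj, Psi_eq]
  simp only [eval_map_conj, Complex.conj_conj] at a1 a2 b1 b2 c1 c2 d1 d2 ⊢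
  intro i j
  fin_cases i <;> fin_cases j
  · constructor
    · refine (a1.fun_mul e1).congr_deriv ?_
      simp [Matrix.mul_apply, Fin.sum_univ_two]
      ring
    · refine (a2.fun_mul e2).congr_deriv ?_
      simp [Matrix.mul_apply, Fin.sum_univ_two]
      field_simp
      ring
  · constructor
    · refine (d1.fun_mul e1).congr_deriv ?_
      simp [Matrix.mul_apply, Fin.sum_univ_two]
      ring
    · refine (d2.fun_mul e2).congr_deriv ?_
      simp [Matrix.mul_apply, Fin.sum_univ_two, map_ofNat]
      field_simp
      ring
  · constructor
    · refine (b1.fun_neg.fun_mul i1).congr_deriv ?_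
      simp [Matrix.mul_apply, Fin.sum_univ_two]
      field_simp
      ring
    · refine (b2.fun_neg.fun_mul i2).congr_deriv ?_
      simp [Matrix.mul_apply, Fin.sum_univ_two]
      field_simp
      ring
  · constructor
    · refine (c1.fun_mul i1).congr_deriv ?_
      simp [Matrix.mul_apply, Fin.sum_univ_two]
      field_simp
    · refine (c2.fun_mul i2).congr_deriv ?_
      simp [Matrix.mul_apply, Fin.sum_univ_two, map_ofNat]
      field_simp
      ring

/-- The columns of `Ψ` encode `(p, q)` and `(q*, -p*)`, and both pairs satisfy the condition at
`α_j`. -/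
theorem vecMul_Psi (hinj : Function.Injective (node α)) (s t : ℝ) (j : Fin N) :
    Matrix.vecMul ![1, c j] (Psi α c s t (α j)) = 0 := by
  have hm := polyLeft_polyRight_mem (c := c) hinj s t
  have h1 := mem_interpModule.1 hm (.inl j)
  have h2 := mem_interpModule.1 (interpModule_star hm) (.inl j)
  simp only [weightLeft, weightRight, node, Sum.elim_inl, eval_neg] at h1 h2
  rw [Psi_eq]
  ext i
  fin_cases i
  · simp [Matrix.vecMul, dotProduct, Fin.sum_univ_two]
    linear_combination h1
  · simp [Matrix.vecMul, dotProduct, Fin.sum_univ_two]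
    linear_combination h2

theorem f_eq (s t : ℝ) (l : ℂ) : f α c s t l = (polyLeft α c s t).eval l := by
  simp [f, Psi_eq, expFun_neg, expFun_ne_zero]

theorem g_eq (s t : ℝ) (l : ℂ) : g α c s t l = -(polyRight α c s t).eval l := by
  simp [g, Psi_eq, expFun_ne_zero]

/-! ### The Pohlmeyer-Lund-Regge equation -/

theorem solitonSolution_eq (hN : 0 < N) (s t : ℝ) :
    solitonSolution α c s t = 2 * Complex.I * conj ((polyRight α c s t).coeff (N - 1)) := by
  rw [solitonSolution, polyRight_coeff_pred hN]

theorem contDiff_solitonSolution (hinj : Function.Injective (node α)) :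
    ContDiff ℝ ∞ fun p : ℝ × ℝ => solitonSolution α c p.1 p.2 :=
  contDiff_const.mul (Complex.conjCLE.contDiff.comp (contDiff_d_div hinj _))

theorem hasDerivAt_solitonSolution_snd (hN : 0 < N) (hinj : Function.Injective (node α))
    (h0 : ∀ i, node α i ≠ 0) (s t : ℝ) :
    HasDerivAt (fun y => solitonSolution α c s y) (-(2 * conj (offDiagCoeff α c s t))) t := by
  simp only [solitonSolution_eq hN]
  refine ((hasDerivAt_polyRight_coeff_pred_snd hN hinj h0 s t).star.const_mul
    (2 * Complex.I)).congr_deriv ?_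
  simp only [star_neg, star_mul', Complex.star_def, Complex.conj_I]
  linear_combination 2 * conj (offDiagCoeff α c s t) * Complex.I_mul_I

/-- Matching the diagonal of the two forms of the `t`-coefficient forces `h = 2 diagCoeff`, and `∂ₜ
q = -2 conj offDiagCoeff`. Both are built from the constant terms of `p` and `q`, so the
`s`-evolution at `λ = 0` gives their `s`-derivatives. -/
theorem isPLRSolution (hN : 0 < N) (hinj : Function.Injective (node α))
    (h0 : ∀ i, node α i ≠ 0) :
    IsPLRSolution (solitonSolution α c) fun s t => 2 * diagCoeff α c s t := by
  -- The denominator is a product over the nodes, hence constant in `s` and inert under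
  -- differentiation.
  have hden : ∀ x s t, ‖(polyLeft α c x t).coeff 0‖ ^ 2 + ‖(polyRight α c x t).coeff 0‖ ^ 2 =
      ‖(polyLeft α c s t).coeff 0‖ ^ 2 + ‖(polyRight α c s t).coeff 0‖ ^ 2 := by
    intro x s t
    have := (norm_sq_coeff_zero (c := c) hinj x t).trans (norm_sq_coeff_zero (c := c) hinj s t).symm
    exact Complex.ofReal_injective this
  have hx : ∀ s t, HasDerivAt (fun x => (polyLeft α c x t).coeff 0)
      (Complex.I * (polyRight α c s t).coeff (N - 1) * conj ((polyRight α c s t).coeff 0)) s := by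
    intro s t
    simpa [eval_map_conj, coeff_zero_eq_eval_zero] using
      hasDerivAt_polyLeft_fst (c := c) hN hinj s t 0
  have hy : ∀ s t, HasDerivAt (fun x => (polyRight α c x t).coeff 0)
      (-(Complex.I * (polyRight α c s t).coeff (N - 1) *
        conj ((polyLeft α c s t).coeff 0))) s := by
    intro s t
    simpa [eval_map_conj, coeff_zero_eq_eval_zero] using
      hasDerivAt_polyRight_fst (c := c) hN hinj s t 0
  refine ⟨contDiff_solitonSolution hinj, fun s t => ?_, fun s t => ?_⟩
  · rw [(hasDerivAt_solitonSolution_snd hN hinj h0 s t).norm_sq.deriv]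
    simp only [diagCoeff, hden _ s t]
    refine ((((hx s t).norm_sq.fun_sub (hy s t).norm_sq).div_const _).const_mul 2).congr_deriv ?_
    simp only [solitonSolution_eq hN, offDiagCoeff]
    generalize ‖(polyLeft α c s t).coeff 0‖ ^ 2 + ‖(polyRight α c s t).coeff 0‖ ^ 2 = D
    generalize (polyLeft α c s t).coeff 0 = u
    generalize (polyRight α c s t).coeff 0 = v
    generalize (polyRight α c s t).coeff (N - 1) = w
    simp [Complex.inner, Complex.div_ofReal_re, Complex.div_ofReal_im]
    ring
  · have hd : ∀ x, deriv (fun y => solitonSolution α c x y) t =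
        -(2 * conj (offDiagCoeff α c x t)) :=
      fun x => (hasDerivAt_solitonSolution_snd hN hinj h0 x t).deriv
    simp only [hd]
    have hD : ((‖(polyLeft α c s t).coeff 0‖ ^ 2 + ‖(polyRight α c s t).coeff 0‖ ^ 2 : ℝ) : ℂ) ≠
        0 := by
      rw [norm_sq_coeff_zero hinj]
      exact Finset.prod_ne_zero_iff.2 fun i _ => neg_ne_zero.2 (h0 i)
    simp only [offDiagCoeff, hden _ s t]
    refine (congrArg (· + _)
      ((((((hx s t).fun_mul (hy s t)).div_const _).star).const_mul 2).fun_neg).deriv).trans ?_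
    rw [solitonSolution_eq hN, diagCoeff]
    push_cast at hD ⊢
    rw [← Complex.mul_conj', ← Complex.mul_conj'] at hD ⊢
    simp
    rw [mul_comm, mul_comm (conj _) ((polyRight α c s t).coeff 0)]
    field_simp
    ring

end WaveFunction

end LundRegge

namespace LundRegge

open Matrix

/-! ### The Sym formula for a family of frames -/

section Sym

/-- Entrywise differentiability of a curve of matrices. -/
def HasMatDerivAt (A : ℝ → Matrix (Fin 2) (Fin 2) ℂ) (A' : Matrix (Fin 2) (Fin 2) ℂ) (x : ℝ) :
    Prop := ∀ i j, HasDerivAt (fun y => A y i j) (A' i j) x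

theorem HasMatDerivAt.mul {A B : ℝ → Matrix (Fin 2) (Fin 2) ℂ}
    {A' B' : Matrix (Fin 2) (Fin 2) ℂ} {x : ℝ} (hA : HasMatDerivAt A A' x)
    (hB : HasMatDerivAt B B' x) :
    HasMatDerivAt (fun y => A y * B y) (A' * B x + A x * B') x := by
  intro i j
  simp only [Matrix.mul_apply, Matrix.add_apply, Fin.sum_univ_two]
  refine (((hA i 0).fun_mul (hB 0 j)).fun_add ((hA i 1).fun_mul (hB 1 j))).congr_deriv ?_
  ring

theorem HasMatDerivAt.conjTranspose {A : ℝ → Matrix (Fin 2) (Fin 2) ℂ}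
    {A' : Matrix (Fin 2) (Fin 2) ℂ} {x : ℝ} (hA : HasMatDerivAt A A' x) :
    HasMatDerivAt (fun y => (A y)ᴴ) A'ᴴ x := fun i j => (hA j i).star

theorem HasMatDerivAt.congr_deriv {A : ℝ → Matrix (Fin 2) (Fin 2) ℂ}
    {A' B' : Matrix (Fin 2) (Fin 2) ℂ} {x : ℝ} (hA : HasMatDerivAt A A' x) (h : A' = B') :
    HasMatDerivAt A B' x := h ▸ hA

theorem HasMatDerivAt.const (A : Matrix (Fin 2) (Fin 2) ℂ) (x : ℝ) :
    HasMatDerivAt (fun _ => A) 0 x := fun _ _ => hasDerivAt_const _ _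

theorem HasMatDerivAt.r3OfSu2 {A : ℝ → Matrix (Fin 2) (Fin 2) ℂ}
    {A' : Matrix (Fin 2) (Fin 2) ℂ} {x : ℝ} (hA : HasMatDerivAt A A' x) :
    HasDerivAt (fun y => r3OfSu2 (A y)) (r3OfSu2 A') x := by
  have hre : ∀ i j, HasDerivAt (fun y => (A y i j).re) (A' i j).re x := fun i j =>
    Complex.reCLM.hasFDerivAt.comp_hasDerivAt x (hA i j)
  have him : ∀ i j, HasDerivAt (fun y => (A y i j).im) (A' i j).im x := fun i j =>
    Complex.imCLM.hasFDerivAt.comp_hasDerivAt x (hA i j)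
  rw [hasDerivAt_pi]
  intro i
  fin_cases i
  · exact (hre 1 0).const_mul 2
  · exact (him 1 0).const_mul (-2)
  · exact (him 0 0).const_mul 2

/-! ### Euclidean geometry of `𝔰𝔲(2)`: commutator as cross product, determinant as squared length -/

theorem su2OfR3_r3OfSu2 {A : Matrix (Fin 2) (Fin 2) ℂ} (h : Aᴴ = -A) (ht : A.trace = 0) :
    su2OfR3 (r3OfSu2 A) = A := by
  have h00 := congrFun (congrFun h 0) 0
  have h01 := congrFun (congrFun h 0) 1
  rw [Matrix.trace_fin_two] at ht
  simp only [Matrix.conjTranspose_apply, Matrix.neg_apply, Complex.star_def] at h00 h01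
  have e11 : A 1 1 = -A 0 0 := by linear_combination ht
  have e01 : A 0 1 = -conj (A 1 0) := by rw [h01, neg_neg]
  have hr := congrArg Complex.re h00
  simp only [Complex.conj_re, Complex.neg_re] at hr
  have hr0 : (A 0 0).re = 0 := by linarith
  ext i j
  fin_cases i <;> fin_cases j <;> apply Complex.ext <;>
    simp [su2OfR3, r3OfSu2, e11, e01, hr0]

theorem det_su2OfR3 (v : Fin 3 → ℝ) :
    (su2OfR3 v).det = ((‖WithLp.toLp 2 v‖ ^ 2 / 4 : ℝ) : ℂ) := by
  rw [EuclideanSpace.norm_sq_eq, Fin.sum_univ_three, su2OfR3, Matrix.det_smul,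
    Matrix.det_fin_two_of]
  simp only [Real.norm_eq_abs, sq_abs, Fintype.card_fin]
  push_cast
  linear_combination (-((v 2 : ℂ) ^ 2 + (v 1 : ℂ) ^ 2) / 4) * Complex.I_sq

theorem su2OfR3_commutator (v w : Fin 3 → ℝ) :
    r3OfSu2 (su2OfR3 v * su2OfR3 w - su2OfR3 w * su2OfR3 v) = crossProduct v w := by
  ext i
  fin_cases i <;> simp [su2OfR3, r3OfSu2, cross_apply] <;> ring

theorem r3OfSu2_commutator {A B : Matrix (Fin 2) (Fin 2) ℂ} (hA : Aᴴ = -A) (hA' : A.trace = 0)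
    (hB : Bᴴ = -B) (hB' : B.trace = 0) :
    r3OfSu2 (A * B - B * A) = crossProduct (r3OfSu2 A) (r3OfSu2 B) := by
  rw [← su2OfR3_commutator, su2OfR3_r3OfSu2 hA hA', su2OfR3_r3OfSu2 hB hB']

theorem norm_r3OfSu2 {A : Matrix (Fin 2) (Fin 2) ℂ} (hA : Aᴴ = -A) (hA' : A.trace = 0)
    (hd : A.det = 1 / 4) : ‖WithLp.toLp 2 (r3OfSu2 A)‖ = 1 := by
  have h := det_su2OfR3 (r3OfSu2 A)
  rw [su2OfR3_r3OfSu2 hA hA', hd] at h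
  have h' : (1 / 4 : ℝ) = ‖WithLp.toLp 2 (r3OfSu2 A)‖ ^ 2 / 4 := by
    apply Complex.ofReal_injective
    rw [← h]
    norm_num
  exact (pow_eq_one_iff_of_nonneg (norm_nonneg _) two_ne_zero).1 (by linarith)

/-! ### Derivatives in the spectral parameter -/

theorem contDiffAt_slice {G : ℝ × ℝ × ℝ → ℂ} (hG : ContDiffOn ℝ ∞ G {p | 0 < p.2.2})
    {p : ℝ × ℝ × ℝ} (hp : 0 < p.2.2) : ContDiffAt ℝ ∞ G p :=
  hG.contDiffAt ((isOpen_lt continuous_const (by fun_prop)).mem_nhds hp)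

/-- The derivative in the last variable as a directional derivative. -/
theorem hasDerivAt_last {G : ℝ × ℝ × ℝ → ℂ} (hG : ContDiffOn ℝ ∞ G {p | 0 < p.2.2})
    (s t : ℝ) {l : ℝ} (hl : 0 < l) :
    HasDerivAt (fun x => G (s, t, x)) (fderiv ℝ G (s, t, l) (0, 0, 1)) l := by
  have h := ((contDiffAt_slice hG (p := (s, t, l)) hl).differentiableAt (by simp)).hasFDerivAt
  refine h.comp_hasDerivAt (f := fun x => (s, t, x)) l ?_
  exact (hasDerivAt_const l s).prodMk ((hasDerivAt_const l t).prodMk (hasDerivAt_id l))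

theorem contDiff_deriv_last {G : ℝ × ℝ × ℝ → ℂ} (hG : ContDiffOn ℝ ∞ G {p | 0 < p.2.2}) :
    ContDiff ℝ ∞ fun p : ℝ × ℝ => deriv (fun x => G (p.1, p.2, x)) 1 := by
  have : (fun p : ℝ × ℝ => deriv (fun x => G (p.1, p.2, x)) 1) =
      fun p : ℝ × ℝ => fderiv ℝ G (p.1, p.2, 1) (0, 0, 1) :=
    funext fun p => (hasDerivAt_last hG p.1 p.2 one_pos).deriv
  rw [this, contDiff_iff_contDiffAt]
  intro p
  have h := (contDiffAt_slice hG (p := (p.1, p.2, 1)) one_pos).fderiv_right (m := ∞) (by simp)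
  refine ContDiffAt.clm_apply ?_ contDiffAt_const
  exact ContDiffAt.comp (f := fun p : ℝ × ℝ => (p.1, p.2, (1 : ℝ))) p h (by fun_prop)

/-- Symmetry of the mixed second derivative along a curve of base points and in the
last variable. -/
theorem hasDerivAt_deriv_last {G : ℝ × ℝ × ℝ → ℂ} (hG : ContDiffOn ℝ ∞ G {p | 0 < p.2.2})
    {S T : ℝ → ℝ} {x S' T' : ℝ} (hS : HasDerivAt S S' x) (hT : HasDerivAt T T' x)
    {H : ℝ → ℂ} {H' : ℂ}
    (hH : ∀ l, 0 < l → fderiv ℝ G (S x, T x, l) (S', T', 0) = H l) (hH' : HasDerivAt H H' 1) :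
    HasDerivAt (fun y => deriv (fun l => G (S y, T y, l)) 1) H' x := by
  have hc := contDiffAt_slice hG (p := (S x, T x, 1)) one_pos
  have hd : HasFDerivAt (fderiv ℝ G) (fderiv ℝ (fderiv ℝ G) (S x, T x, 1)) (S x, T x, 1) :=
    ((hc.fderiv_right (m := 1) (by norm_cast)).differentiableAt (by simp)).hasFDerivAt
  have hsymm : IsSymmSndFDerivAt ℝ G (S x, T x, 1) := hc.isSymmSndFDerivAt (by simp; norm_cast)
  have h1 : HasDerivAt (fun y => fderiv ℝ G (S y, T y, 1) (0, 0, 1))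
      (fderiv ℝ (fderiv ℝ G) (S x, T x, 1) (S', T', 0) (0, 0, 1)) x := by
    have hcurve : HasDerivAt (fun y => (S y, T y, (1 : ℝ))) (S', T', 0) x :=
      hS.prodMk (hT.prodMk (hasDerivAt_const x 1))
    have := hd.comp_hasDerivAt (f := fun y => (S y, T y, (1 : ℝ))) x hcurve
    exact (ContinuousLinearMap.apply ℝ ℂ ((0, 0, 1) : ℝ × ℝ × ℝ)).hasFDerivAt.comp_hasDerivAt x
      this
  have h2 : HasDerivAt (fun l => fderiv ℝ G (S x, T x, l) (S', T', 0))
      (fderiv ℝ (fderiv ℝ G) (S x, T x, 1) (0, 0, 1) (S', T', 0)) 1 := by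
    have hcurve : HasDerivAt (fun l : ℝ => (S x, T x, l)) (0, 0, 1) 1 :=
      (hasDerivAt_const 1 _).prodMk ((hasDerivAt_const 1 _).prodMk (hasDerivAt_id 1))
    have := hd.comp_hasDerivAt (f := fun l => (S x, T x, l)) 1 hcurve
    exact (ContinuousLinearMap.apply ℝ ℂ ((S', T', 0) : ℝ × ℝ × ℝ)).hasFDerivAt.comp_hasDerivAt
      1 this
  -- The identity with `H` holds for positive parameters only, but these form a neighbourhood of
  -- `1`.
  have h3 : HasDerivAt (fun l => fderiv ℝ G (S x, T x, l) (S', T', 0)) H' 1 := by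
    refine hH'.congr_of_eventuallyEq ?_
    filter_upwards [lt_mem_nhds one_pos] with l hl using hH l hl
  have h4 : (fun y => deriv (fun l => G (S y, T y, l)) 1) =
      fun y => fderiv ℝ G (S y, T y, 1) (0, 0, 1) :=
    funext fun y => (hasDerivAt_last hG (S y) (T y) one_pos).deriv
  rw [h4, h3.unique h2, ← hsymm.eq]
  exact h1

variable {F : ℝ → ℝ → ℝ → Matrix (Fin 2) (Fin 2) ℂ} {q : ℝ → ℝ → ℂ} {h : ℝ → ℝ → ℝ}

/-- The derivative of a frame in the spectral parameter at `1`. -/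
noncomputable def spectralDeriv (F : ℝ → ℝ → ℝ → Matrix (Fin 2) (Fin 2) ℂ) (s t : ℝ) :
    Matrix (Fin 2) (Fin 2) ℂ := Matrix.of fun i j => deriv (fun l : ℝ => F s t l i j) 1

theorem conjTranspose_mul_self_of_mem {A : Matrix (Fin 2) (Fin 2) ℂ}
    (hA : A ∈ specialUnitaryGroup (Fin 2) ℂ) : Aᴴ * A = 1 :=
  mem_unitaryGroup_iff'.1 (mem_specialUnitaryGroup_iff.1 hA).1

theorem inv_eq_conjTranspose_of_mem {A : Matrix (Fin 2) (Fin 2) ℂ}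
    (hA : A ∈ specialUnitaryGroup (Fin 2) ℂ) : A⁻¹ = Aᴴ :=
  inv_eq_left_inv (conjTranspose_mul_self_of_mem hA)

theorem symFormula_eq (hSU : ∀ s t l, 0 < l → F s t l ∈ specialUnitaryGroup (Fin 2) ℂ)
    (s t : ℝ) : symFormula F s t = spectralDeriv F s t * (F s t 1)ᴴ := by
  rw [symFormula, inv_eq_conjTranspose_of_mem (hSU s t 1 one_pos)]
  rfl

theorem hasMatDerivAt_spectral
    (hF : ∀ i j, ContDiffOn ℝ ∞ (fun p : ℝ × ℝ × ℝ => F p.1 p.2.1 p.2.2 i j) {p | 0 < p.2.2})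
    (s t : ℝ) : HasMatDerivAt (fun l => F s t l) (spectralDeriv F s t) 1 :=
  fun i j => (hasDerivAt_last (hF i j) s t one_pos).differentiableAt.hasDerivAt

/-- Differentiate `F Fᴴ = 1` in `λ`. -/
theorem conjTranspose_symFormula
    (hF : ∀ i j, ContDiffOn ℝ ∞ (fun p : ℝ × ℝ × ℝ => F p.1 p.2.1 p.2.2 i j) {p | 0 < p.2.2})
    (hSU : ∀ s t l, 0 < l → F s t l ∈ specialUnitaryGroup (Fin 2) ℂ) (s t : ℝ) :
    (symFormula F s t)ᴴ = -symFormula F s t := by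
  have hd := hasMatDerivAt_spectral hF s t
  have h1 := hd.mul hd.conjTranspose
  have h0 : spectralDeriv F s t * (F s t 1)ᴴ + F s t 1 * (spectralDeriv F s t)ᴴ = 0 := by
    ext i j
    refine (h1 i j).unique (((hasDerivAt_const (1 : ℝ)
      ((1 : Matrix (Fin 2) (Fin 2) ℂ) i j))).congr_of_eventuallyEq ?_)
    filter_upwards [lt_mem_nhds one_pos] with l hl
    have := mem_unitaryGroup_iff.1 (mem_specialUnitaryGroup_iff.1 (hSU s t l hl)).1
    exact congrFun (congrFun this i) j
  rw [symFormula_eq hSU, conjTranspose_mul, conjTranspose_conjTranspose]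
  exact eq_neg_of_add_eq_zero_right h0

/-- Differentiate `det F = 1` in `λ`; with `F⁻¹ = adj F` the result is the trace. -/
theorem trace_symFormula
    (hF : ∀ i j, ContDiffOn ℝ ∞ (fun p : ℝ × ℝ × ℝ => F p.1 p.2.1 p.2.2 i j) {p | 0 < p.2.2})
    (hSU : ∀ s t l, 0 < l → F s t l ∈ specialUnitaryGroup (Fin 2) ℂ) (s t : ℝ) :
    (symFormula F s t).trace = 0 := by
  have hd := hasMatDerivAt_spectral hF s t
  have h1 := ((hd 0 0).fun_mul (hd 1 1)).fun_sub ((hd 0 1).fun_mul (hd 1 0))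
  have h0 := h1.unique (((hasDerivAt_const (1 : ℝ) (1 : ℂ))).congr_of_eventuallyEq (by
    filter_upwards [lt_mem_nhds one_pos] with l hl
    rw [← det_fin_two]
    exact (mem_specialUnitaryGroup_iff.1 (hSU s t l hl)).2))
  have hinv : (F s t 1)⁻¹ = (F s t 1).adjugate := by
    rw [inv_def, (mem_specialUnitaryGroup_iff.1 (hSU s t 1 one_pos)).2]
    simp
  change (spectralDeriv F s t * (F s t 1)⁻¹).trace = 0
  rw [hinv, adjugate_fin_two, trace_fin_two]
  simp only [Matrix.mul_apply, Fin.sum_univ_two]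
  simp
  linear_combination h0

/-- The `λ`-derivative of `L` is thus the constant third basis vector of `𝔰𝔲(2)`, free of `q`; this
is the source of unit speed. -/
theorem laxL_eq_add (q : ℝ → ℝ → ℂ) (l s t : ℝ) :
    laxL q l s t = laxL q 0 s t + (l : ℂ) • su2OfR3 ![0, 0, 1] := by
  ext i j
  fin_cases i <;> fin_cases j <;> simp [laxL, su2OfR3] <;> ring

/-- Homogeneity of degree `-1` makes the `λ`-derivative at `1` equal to `-M`. -/
theorem laxM_eq_smul (q : ℝ → ℝ → ℂ) (h : ℝ → ℝ → ℝ) (l s t : ℝ) :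
    laxM q h l s t = (l : ℂ)⁻¹ • laxM q h 1 s t := by
  rw [laxM, laxM, smul_smul]
  congr 1
  rw [Complex.ofReal_one, mul_one, div_eq_mul_inv, mul_inv, div_eq_mul_inv]
  ring

theorem conjTranspose_laxL (q : ℝ → ℝ → ℂ) (l s t : ℝ) : (laxL q l s t)ᴴ = -laxL q l s t := by
  ext i j
  fin_cases i <;> fin_cases j <;> simp [laxL, Matrix.conjTranspose_apply]

theorem conjTranspose_laxM (q : ℝ → ℝ → ℂ) (h : ℝ → ℝ → ℝ) (s t : ℝ) :
    (laxM q h 1 s t)ᴴ = -laxM q h 1 s t := by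
  ext i j
  fin_cases i <;> fin_cases j <;> simp [laxM, Matrix.conjTranspose_apply] <;> ring

theorem trace_laxM (q : ℝ → ℝ → ℂ) (h : ℝ → ℝ → ℝ) (s t : ℝ) : (laxM q h 1 s t).trace = 0 := by
  simp [laxM, trace_fin_two]

theorem conjTranspose_su2OfR3 (v : Fin 3 → ℝ) : (su2OfR3 v)ᴴ = -su2OfR3 v := by
  ext i j
  fin_cases i <;> fin_cases j <;> simp [su2OfR3, Matrix.conjTranspose_apply] <;> ring

theorem trace_su2OfR3 (v : Fin 3 → ℝ) : (su2OfR3 v).trace = 0 := by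
  simp [su2OfR3, trace_fin_two]

theorem hasDerivAt_spectral_mul_laxL
    (hF : ∀ i j, ContDiffOn ℝ ∞ (fun p : ℝ × ℝ × ℝ => F p.1 p.2.1 p.2.2 i j) {p | 0 < p.2.2})
    (s t : ℝ) : HasMatDerivAt (fun l => F s t l * laxL q l s t)
      (spectralDeriv F s t * laxL q 1 s t + F s t 1 * su2OfR3 ![0, 0, 1]) 1 := by
  refine (hasMatDerivAt_spectral hF s t).mul fun i j => ?_
  have e : (fun l => laxL q l s t i j) =
      fun l : ℝ => laxL q 0 s t i j + (l : ℂ) * su2OfR3 ![0, 0, 1] i j :=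
    funext fun l => congrFun (congrFun (laxL_eq_add q l s t) i) j
  rw [e]
  have h1 : HasDerivAt (fun x : ℝ => (x : ℂ)) 1 1 := Complex.ofRealCLM.hasDerivAt
  exact ((h1.mul_const _).const_add _).congr_deriv (one_mul _)

theorem hasDerivAt_spectral_mul_laxM
    (hF : ∀ i j, ContDiffOn ℝ ∞ (fun p : ℝ × ℝ × ℝ => F p.1 p.2.1 p.2.2 i j) {p | 0 < p.2.2})
    (s t : ℝ) : HasMatDerivAt (fun l => F s t l * laxM q h l s t)
      (spectralDeriv F s t * laxM q h 1 s t + F s t 1 * -laxM q h 1 s t) 1 := by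
  refine (hasMatDerivAt_spectral hF s t).mul fun i j => ?_
  have e : (fun l => laxM q h l s t i j) = fun l : ℝ => (l : ℂ)⁻¹ * laxM q h 1 s t i j :=
    funext fun l => congrFun (congrFun (laxM_eq_smul q h l s t) i) j
  rw [e]
  have h1 : HasDerivAt (fun x : ℝ => (x : ℂ)) 1 1 := Complex.ofRealCLM.hasDerivAt
  refine ((h1.fun_inv (by simp)).mul_const _).congr_deriv ?_
  simp

/-- Exchanging derivatives gives `∂ₛ F_λ = F_λ L + F L_λ`. The derivative of `Fᴴ` contributes `-F_λ
L Fᴴ`, as `L` is skew-Hermitian, and only `F L_λ Fᴴ` survives. -/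
theorem hasMatDerivAt_symFormula_fst
    (hF : ∀ i j, ContDiffOn ℝ ∞ (fun p : ℝ × ℝ × ℝ => F p.1 p.2.1 p.2.2 i j) {p | 0 < p.2.2})
    (hSU : ∀ s t l, 0 < l → F s t l ∈ specialUnitaryGroup (Fin 2) ℂ)
    (hLax : ∀ l, 0 < l → SolvesLaxPair (fun s t => F s t l) (laxL q l) (laxM q h l))
    (s t : ℝ) : HasMatDerivAt (fun x => symFormula F x t)
      (F s t 1 * su2OfR3 ![0, 0, 1] * (F s t 1)ᴴ) s := by
  have hG : HasMatDerivAt (fun x => spectralDeriv F x t)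
      (spectralDeriv F s t * laxL q 1 s t + F s t 1 * su2OfR3 ![0, 0, 1]) s := by
    intro i j
    refine hasDerivAt_deriv_last (hF i j) (hasDerivAt_id s) (hasDerivAt_const s t)
      (fun l hl => ?_) (hasDerivAt_spectral_mul_laxL hF s t i j)
    have hc := ((contDiffAt_slice (hF i j) (p := (s, t, l)) hl).differentiableAt
      (by simp)).hasFDerivAt
    exact (hc.comp_hasDerivAt (f := fun x => (x, t, l)) s ((hasDerivAt_id s).prodMk
      ((hasDerivAt_const s t).prodMk (hasDerivAt_const s l)))).unique (hLax l hl s t i j).1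
  have hF1 : HasMatDerivAt (fun x => F x t 1) (F s t 1 * laxL q 1 s t) s :=
    fun i j => (hLax 1 one_pos s t i j).1
  simp only [symFormula_eq hSU]
  refine (hG.mul hF1.conjTranspose).congr_deriv ?_
  rw [conjTranspose_mul, conjTranspose_laxL]
  noncomm_ring

theorem hasMatDerivAt_symFormula_snd
    (hF : ∀ i j, ContDiffOn ℝ ∞ (fun p : ℝ × ℝ × ℝ => F p.1 p.2.1 p.2.2 i j) {p | 0 < p.2.2})
    (hSU : ∀ s t l, 0 < l → F s t l ∈ specialUnitaryGroup (Fin 2) ℂ)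
    (hLax : ∀ l, 0 < l → SolvesLaxPair (fun s t => F s t l) (laxL q l) (laxM q h l))
    (s t : ℝ) : HasMatDerivAt (fun y => symFormula F s y)
      (F s t 1 * -laxM q h 1 s t * (F s t 1)ᴴ) t := by
  have hG : HasMatDerivAt (fun y => spectralDeriv F s y)
      (spectralDeriv F s t * laxM q h 1 s t + F s t 1 * -laxM q h 1 s t) t := by
    intro i j
    refine hasDerivAt_deriv_last (hF i j) (hasDerivAt_const t s) (hasDerivAt_id t)
      (fun l hl => ?_) (hasDerivAt_spectral_mul_laxM hF s t i j)
    have hc := ((contDiffAt_slice (hF i j) (p := (s, t, l)) hl).differentiableAt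
      (by simp)).hasFDerivAt
    exact (hc.comp_hasDerivAt (f := fun y => (s, y, l)) t ((hasDerivAt_const t s).prodMk
      ((hasDerivAt_id t).prodMk (hasDerivAt_const t l)))).unique (hLax l hl s t i j).2
  have hF1 : HasMatDerivAt (fun y => F s y 1) (F s t 1 * laxM q h 1 s t) t :=
    fun i j => (hLax 1 one_pos s t i j).2
  simp only [symFormula_eq hSU]
  refine (hG.mul hF1.conjTranspose).congr_deriv ?_
  rw [conjTranspose_mul, conjTranspose_laxM]
  noncomm_ring

theorem conjTranspose_conj_frame {A B : Matrix (Fin 2) (Fin 2) ℂ} (hB : Bᴴ = -B) :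
    (A * B * Aᴴ)ᴴ = -(A * B * Aᴴ) := by
  rw [conjTranspose_mul, conjTranspose_mul, conjTranspose_conjTranspose, hB]
  noncomm_ring

theorem trace_conj_frame {A B : Matrix (Fin 2) (Fin 2) ℂ}
    (hA : A ∈ specialUnitaryGroup (Fin 2) ℂ) : (A * B * Aᴴ).trace = B.trace := by
  rw [trace_mul_comm, ← Matrix.mul_assoc, conjTranspose_mul_self_of_mem hA, Matrix.one_mul]

theorem contDiff_symFormula
    (hF : ∀ i j, ContDiffOn ℝ ∞ (fun p : ℝ × ℝ × ℝ => F p.1 p.2.1 p.2.2 i j) {p | 0 < p.2.2})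
    (hSU : ∀ s t l, 0 < l → F s t l ∈ specialUnitaryGroup (Fin 2) ℂ) (i j : Fin 2) :
    ContDiff ℝ ∞ fun p : ℝ × ℝ => symFormula F p.1 p.2 i j := by
  have hF1 : ∀ i j, ContDiff ℝ ∞ fun p : ℝ × ℝ => F p.1 p.2 1 i j := by
    intro i j
    rw [contDiff_iff_contDiffAt]
    intro p
    exact ContDiffAt.comp (f := fun p : ℝ × ℝ => (p.1, p.2, (1 : ℝ))) p
      (contDiffAt_slice (hF i j) (p := (p.1, p.2, 1)) one_pos) (by fun_prop)
  simp only [symFormula_eq hSU, Matrix.mul_apply, conjTranspose_apply]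
  exact ContDiff.sum fun k _ => (contDiff_deriv_last (hF i k)).mul
    (Complex.conjCLE.contDiff.comp (hF1 j k))

/-- Let `E` be the third basis vector of `𝔰𝔲(2)`. Differentiating `γ' = F E Fᴴ` in `t` gives `F [M,
E] Fᴴ`, and this is the commutator of `F E Fᴴ` with `∂ₜ γ = -F M Fᴴ`, that is, the cross product. -/
theorem isLundReggeEvolution_symFormula
    (hF : ∀ i j, ContDiffOn ℝ ∞ (fun p : ℝ × ℝ × ℝ => F p.1 p.2.1 p.2.2 i j) {p | 0 < p.2.2})
    (hSU : ∀ s t l, 0 < l → F s t l ∈ specialUnitaryGroup (Fin 2) ℂ)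
    (hLax : ∀ l, 0 < l → SolvesLaxPair (fun s t => F s t l) (laxL q l) (laxM q h l)) :
    IsLundReggeEvolution fun s t => r3OfSu2 (symFormula F s t) := by
  refine ⟨?_, fun s t => ?_⟩
  · have hre : ∀ i j, ContDiff ℝ ∞ fun p : ℝ × ℝ => (symFormula F p.1 p.2 i j).re := fun i j =>
      Complex.reCLM.contDiff.comp (contDiff_symFormula hF hSU i j)
    have him : ∀ i j, ContDiff ℝ ∞ fun p : ℝ × ℝ => (symFormula F p.1 p.2 i j).im := fun i j =>
      Complex.imCLM.contDiff.comp (contDiff_symFormula hF hSU i j)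
    rw [contDiff_pi]
    intro i
    fin_cases i
    · exact contDiff_const.mul (hre 1 0)
    · exact contDiff_const.mul (him 1 0)
    · exact contDiff_const.mul (him 0 0)
  · have h1 := fun y => (hasMatDerivAt_symFormula_fst hF hSU hLax s y).r3OfSu2.deriv
    have hF1 : HasMatDerivAt (fun y => F s y 1) (F s t 1 * laxM q h 1 s t) t :=
      fun i j => (hLax 1 one_pos s t i j).2
    have h2 := ((hF1.mul (HasMatDerivAt.const (su2OfR3 ![0, 0, 1]) t)).mul
      hF1.conjTranspose).r3OfSu2.deriv
    have hA := hSU s t 1 one_pos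
    have hU := conjTranspose_mul_self_of_mem hA
    simp only [h1]
    rw [h2, (hasMatDerivAt_symFormula_snd hF hSU hLax s t).r3OfSu2.deriv, ← r3OfSu2_commutator
      (conjTranspose_conj_frame (conjTranspose_su2OfR3 _))
      (by rw [trace_conj_frame hA, trace_su2OfR3])
      (conjTranspose_conj_frame (by rw [conjTranspose_neg, conjTranspose_laxM]))
      (by rw [trace_conj_frame hA, trace_neg, trace_laxM, neg_zero])]
    congr 1
    have assoc : ∀ B B' : Matrix (Fin 2) (Fin 2) ℂ, F s t 1 * B * (F s t 1)ᴴ *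
        (F s t 1 * B' * (F s t 1)ᴴ) = F s t 1 * (B * B') * (F s t 1)ᴴ := by
      intro B B'
      calc _ = F s t 1 * B * ((F s t 1)ᴴ * F s t 1) * B' * (F s t 1)ᴴ := by noncomm_ring
        _ = _ := by rw [hU]; noncomm_ring
    rw [assoc, assoc, conjTranspose_mul, conjTranspose_laxM]
    noncomm_ring

/-- Conjugation by `F` preserves the determinant, a quarter of the squared length, so `γ'` is as
long as the basis vector it is conjugate to. -/
theorem hasUnitSpeed_symFormula
    (hF : ∀ i j, ContDiffOn ℝ ∞ (fun p : ℝ × ℝ × ℝ => F p.1 p.2.1 p.2.2 i j) {p | 0 < p.2.2})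
    (hSU : ∀ s t l, 0 < l → F s t l ∈ specialUnitaryGroup (Fin 2) ℂ)
    (hLax : ∀ l, 0 < l → SolvesLaxPair (fun s t => F s t l) (laxL q l) (laxM q h l)) :
    HasUnitSpeed fun s t => r3OfSu2 (symFormula F s t) := by
  intro s t
  have hA := hSU s t 1 one_pos
  rw [(hasMatDerivAt_symFormula_fst hF hSU hLax s t).r3OfSu2.deriv]
  refine norm_r3OfSu2 (conjTranspose_conj_frame (conjTranspose_su2OfR3 _))
    (by rw [trace_conj_frame hA, trace_su2OfR3]) ?_
  rw [det_mul, det_mul, det_conjTranspose, (mem_specialUnitaryGroup_iff.1 hA).2, det_su2OfR3,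
    EuclideanSpace.norm_sq_eq, Fin.sum_univ_three]
  simp

end Sym

end LundRegge

namespace LundRegge

open Polynomial

/-! ### The normalized wave function -/

section Frame

variable {N : ℕ} {α c : Fin N → ℂ}

theorem conj_expFun_ofReal (s t l : ℝ) :
    conj (expFun s t (l : ℂ)) = (expFun s t (l : ℂ))⁻¹ := by
  rw [conj_expFun, Complex.conj_ofReal]

theorem det_Psi (s t l : ℝ) : (Psi α c s t (l : ℂ)).det =
    ((‖f α c s t l‖ ^ 2 + ‖g α c s t l‖ ^ 2 : ℝ) : ℂ) := by
  have he := expFun_ne_zero s t (l : ℂ)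
  rw [f_eq, g_eq, norm_neg, ← eval_hermPoly_ofReal, Psi_eq, Matrix.det_fin_two_of, hermPoly,
    eval_add, eval_mul, eval_mul]
  field_simp
  ring

theorem norm_sq_f_add_norm_sq_g (hinj : Function.Injective (node α)) (s t l : ℝ) :
    ((‖f α c s t l‖ ^ 2 + ‖g α c s t l‖ ^ 2 : ℝ) : ℂ) = ∏ i, ((l : ℂ) - node α i) := by
  rw [f_eq, g_eq, norm_neg, ← eval_hermPoly_ofReal, hermPoly_polyLeft_polyRight hinj, eval_prod]
  simp

/-- The determinant of the wave function, as a function of a real spectral parameter. -/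
noncomputable def detFun (α : Fin N → ℂ) (l : ℝ) : ℝ := (∏ i, ((l : ℂ) - node α i)).re

theorem detFun_eq (hinj : Function.Injective (node α)) (s t l : ℝ) :
    ‖f α c s t l‖ ^ 2 + ‖g α c s t l‖ ^ 2 = detFun α l := by
  rw [detFun, ← norm_sq_f_add_norm_sq_g (c := c) hinj s t l, Complex.ofReal_re]

theorem detFun_pos (hinj : Function.Injective (node α)) (him : ∀ i, (node α i).im ≠ 0) (l : ℝ) :
    0 < detFun α l := by
  -- The product over the nodes does not involve `c`, `s` or `t`, so any values of these serve to
  -- show that it is real and nonnegative.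
  have h := norm_sq_f_add_norm_sq_g (c := (0 : Fin N → ℂ)) hinj 0 0 l
  have hne : ∏ i, ((l : ℂ) - node α i) ≠ 0 := by
    refine Finset.prod_ne_zero_iff.2 fun i _ hi => him i ?_
    rw [← sub_eq_zero.1 hi, Complex.ofReal_im]
  rw [← h, Complex.ofReal_ne_zero] at hne
  rw [← detFun_eq (c := (0 : Fin N → ℂ)) hinj 0 0 l]
  exact lt_of_le_of_ne (by positivity) hne.symm

theorem frame_eq (hinj : Function.Injective (node α)) (s t l : ℝ) :
    frame α c s t l = (((Real.sqrt (detFun α l))⁻¹ : ℝ) : ℂ) • Psi α c s t (l : ℂ) := by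
  rw [frame, det_Psi, Complex.ofReal_re, detFun_eq hinj, Complex.ofReal_inv]

theorem contDiff_detFun : ContDiff ℝ ∞ (detFun α) := by
  refine Complex.reCLM.contDiff.comp (contDiff_prod fun i _ => ?_)
  exact Complex.ofRealCLM.contDiff.sub contDiff_const

theorem frame_mem (hinj : Function.Injective (node α)) (him : ∀ i, (node α i).im ≠ 0)
    (s t l : ℝ) : frame α c s t l ∈ Matrix.specialUnitaryGroup (Fin 2) ℂ := by
  have hpos := detFun_pos hinj him l
  have hsq : ((((Real.sqrt (detFun α l))⁻¹ : ℝ) : ℂ)) ^ 2 * (detFun α l : ℂ) = 1 := by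
    rw [← Complex.ofReal_pow, inv_pow, Real.sq_sqrt hpos.le, ← Complex.ofReal_mul,
      inv_mul_cancel₀ hpos.ne', Complex.ofReal_one]
  have hdet := (det_Psi (α := α) (c := c) s t l).trans (congrArg _ (detFun_eq hinj s t l))
  rw [frame_eq hinj, Matrix.mem_specialUnitaryGroup_iff, Matrix.mem_unitaryGroup_iff]
  constructor
  -- For real `λ` the matrix has the quaternionic shape with rows `(a, -conj b)` and `(b, conj a)`,
  -- so `Ψ Ψᴴ` is `det Ψ` times the identity.
  · have hdet' := hdet
    rw [Matrix.det_fin_two] at hdet'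
    rw [Matrix.star_eq_conjTranspose]
    simp only [Psi, Complex.conj_ofReal, Matrix.of_apply, Matrix.cons_val', Matrix.cons_val_zero,
      Matrix.cons_val_one, Matrix.cons_val_fin_one] at hdet' ⊢
    ext i j
    fin_cases i <;> fin_cases j <;>
      simp [Matrix.mul_apply, Fin.sum_univ_two, Matrix.conjTranspose_apply] at hsq hdet' ⊢
    · rw [← hdet'] at hsq
      linear_combination hsq
    · ring
    · ring
    · rw [← hdet'] at hsq
      linear_combination hsq
  · rw [Matrix.det_smul, Fintype.card_fin, hdet, hsq]

theorem contDiffOn_expFun :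
    ContDiffOn ℝ ∞ (fun p : ℝ × ℝ × ℝ => expFun p.1 p.2.1 (p.2.2 : ℂ)) {p | 0 < p.2.2} := by
  have h1 : ContDiff ℝ ∞ fun p : ℝ × ℝ × ℝ => (p.1 : ℂ) :=
    Complex.ofRealCLM.contDiff.comp contDiff_fst
  have h2 : ContDiff ℝ ∞ fun p : ℝ × ℝ × ℝ => (p.2.1 : ℂ) :=
    Complex.ofRealCLM.contDiff.comp (contDiff_fst.comp contDiff_snd)
  have h3 : ContDiff ℝ ∞ fun p : ℝ × ℝ × ℝ => (p.2.2 : ℂ) :=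
    Complex.ofRealCLM.contDiff.comp (contDiff_snd.comp contDiff_snd)
  unfold expFun
  refine ContDiffOn.cexp (contDiffOn_const.mul ((h3.mul h1).contDiffOn.add
    (ContDiffOn.mul (h3.contDiffOn.inv fun p hp => ?_) h2.contDiffOn)))
  exact Complex.ofReal_ne_zero.2 (ne_of_gt hp)

theorem contDiff_eval_coeffPoly {v : ℝ → ℝ → Fin N → ℂ}
    (hv : ∀ j, ContDiff ℝ ∞ fun p : ℝ × ℝ => v p.1 p.2 j) :
    ContDiff ℝ ∞ fun p : ℝ × ℝ × ℝ => (coeffPoly (v p.1 p.2.1)).eval (p.2.2 : ℂ) := by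
  have h3 : ContDiff ℝ ∞ fun p : ℝ × ℝ × ℝ => (p.2.2 : ℂ) :=
    Complex.ofRealCLM.contDiff.comp (contDiff_snd.comp contDiff_snd)
  simp only [eval_coeffPoly]
  refine ContDiff.sum fun j _ => ContDiff.mul ?_ (h3.pow _)
  exact (hv j).comp (contDiff_fst.prodMk (contDiff_fst.comp contDiff_snd))

theorem contDiffOn_frame (hinj : Function.Injective (node α)) (him : ∀ i, (node α i).im ≠ 0)
    (i j : Fin 2) : ContDiffOn ℝ ∞
      (fun p : ℝ × ℝ × ℝ => frame α c p.1 p.2.1 p.2.2 i j) {p | 0 < p.2.2} := by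
  have h3 : ContDiff ℝ ∞ fun p : ℝ × ℝ × ℝ => (p.2.2 : ℂ) :=
    Complex.ofRealCLM.contDiff.comp (contDiff_snd.comp contDiff_snd)
  have hP : ContDiff ℝ ∞ fun p : ℝ × ℝ × ℝ => (polyLeft α c p.1 p.2.1).eval (p.2.2 : ℂ) := by
    simp only [polyLeft, eval_add, eval_pow, eval_X]
    exact (h3.pow N).add (contDiff_eval_coeffPoly fun j => contDiff_d_div hinj _)
  have hY : ContDiff ℝ ∞ fun p : ℝ × ℝ × ℝ => (polyRight α c p.1 p.2.1).eval (p.2.2 : ℂ) :=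
    contDiff_eval_coeffPoly fun j => contDiff_d_div hinj _
  have hR : ContDiff ℝ ∞ fun p : ℝ × ℝ × ℝ => (((Real.sqrt (detFun α p.2.2))⁻¹ : ℝ) : ℂ) := by
    refine Complex.ofRealCLM.contDiff.comp (ContDiff.inv (ContDiff.sqrt
      (contDiff_detFun.comp (contDiff_snd.comp contDiff_snd)) fun p => ?_) fun p => ?_)
    · exact (detFun_pos hinj him _).ne'
    · exact (Real.sqrt_pos.2 (detFun_pos hinj him _)).ne'
  have he := contDiffOn_expFun
  have hi : ContDiffOn ℝ ∞ (fun p : ℝ × ℝ × ℝ => (expFun p.1 p.2.1 (p.2.2 : ℂ))⁻¹)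
      {p | 0 < p.2.2} := he.inv fun p _ => expFun_ne_zero _ _ _
  simp only [frame_eq hinj, Psi_eq, Matrix.smul_apply, smul_eq_mul, eval_map_conj,
    Complex.conj_ofReal]
  refine hR.contDiffOn.mul ?_
  fin_cases i <;> fin_cases j
  · exact hP.contDiffOn.mul he
  · exact (Complex.conjCLE.contDiff.comp hY).contDiffOn.mul he
  · exact hY.neg.contDiffOn.mul hi
  · exact (Complex.conjCLE.contDiff.comp hP).contDiffOn.mul hi

theorem frame_solvesLaxPair (hN : 0 < N) (hinj : Function.Injective (node α))
    (h0 : ∀ i, node α i ≠ 0) {l : ℝ} (hl : 0 < l) :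
    SolvesLaxPair (fun s t => frame α c s t l) (laxL (solitonSolution α c) l)
      (laxM (solitonSolution α c) (fun s t => 2 * diagCoeff α c s t) l) := by
  intro s t i j
  have hL : laxL (solitonSolution α c) l s t = dateL α c s t (l : ℂ) := by
    rw [laxL, dateL_eq hN, solitonSolution_eq hN]
    simp [map_ofNat]
  have hM : laxM (solitonSolution α c) (fun s t => 2 * diagCoeff α c s t) l s t =
      dateM α c s t (l : ℂ) := by
    rw [laxM, dateM_eq hN hinj, (hasDerivAt_solitonSolution_snd hN hinj h0 s t).deriv]
    simp [map_ofNat]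
  have h := Psi_solvesLaxPair (c := c) hN hinj h0
    (Complex.ofReal_ne_zero.2 hl.ne' : (l : ℂ) ≠ 0) s t i j
  rw [hL, hM]
  simp only [frame_eq hinj, Matrix.smul_mul, Matrix.smul_apply, smul_eq_mul]
  exact ⟨h.1.const_mul _, h.2.const_mul _⟩

/-! ### The explicit formula for the curve -/

theorem hasDerivAt_expFun_ofReal (s t : ℝ) :
    HasDerivAt (fun l : ℝ => expFun s t (l : ℂ))
      (Complex.I / 2 * ((s : ℂ) - t) * expFun s t 1) 1 := by
  have h1 : HasDerivAt (fun x : ℝ => (x : ℂ)) 1 1 := Complex.ofRealCLM.hasDerivAt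
  unfold expFun
  refine ((((h1.mul_const (s : ℂ)).fun_add ((h1.fun_inv (by simp)).mul_const (t : ℂ))).const_mul
    (Complex.I / 2)).cexp).congr_deriv ?_
  simp
  ring

theorem hasDerivAt_f (s t : ℝ) : HasDerivAt (fun l : ℝ => f α c s t (l : ℂ))
    (deriv (fun l : ℝ => f α c s t (l : ℂ)) 1) 1 := by
  simp only [f_eq]
  exact ((polyLeft α c s t).hasDerivAt ((1 : ℝ) : ℂ)).comp_ofReal.differentiableAt.hasDerivAt

theorem hasDerivAt_g (s t : ℝ) : HasDerivAt (fun l : ℝ => g α c s t (l : ℂ))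
    (deriv (fun l : ℝ => g α c s t (l : ℂ)) 1) 1 := by
  simp only [g_eq]
  exact ((polyRight α c s t).hasDerivAt
    ((1 : ℝ) : ℂ)).comp_ofReal.fun_neg.differentiableAt.hasDerivAt

theorem frame_eq_f_g (hinj : Function.Injective (node α)) (s t l : ℝ) : frame α c s t l =
    (((Real.sqrt (detFun α l))⁻¹ : ℝ) : ℂ) •
      !![f α c s t l * expFun s t l, -conj (g α c s t l) * expFun s t l;
        g α c s t l * (expFun s t l)⁻¹, conj (f α c s t l) * (expFun s t l)⁻¹] := by
  rw [frame_eq hinj, Psi_eq, f_eq, g_eq]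
  simp only [eval_map_conj, Complex.conj_ofReal, map_neg, neg_neg]

/-- The frame is `R diag(e, e⁻¹)` times a matrix in `f` and `g`, with `R = (det Ψ)^(-1/2)`. The
diagonal factor gives the term in `s - t` and the conjugation that puts `e⁻² = conj e ^ 2` in the
lower left entry. The real number `r` comes from `R` and is lost on taking imaginary parts. -/
theorem symFormula_frame (hinj : Function.Injective (node α)) (him : ∀ i, (node α i).im ≠ 0)
    (s t : ℝ) :
    symFormula (frame α c) s t 1 0 =
      (conj (f α c s t 1) * deriv (fun l : ℝ => g α c s t l) 1
          - g α c s t 1 * deriv (fun l : ℝ => conj (f α c s t l)) 1)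
        / (f α c s t 1 * conj (f α c s t 1) + g α c s t 1 * conj (g α c s t 1))
        * conj (expFun s t 1) ^ 2 ∧
    ∃ r : ℝ, symFormula (frame α c) s t 0 0 = r + Complex.I / 2 * ((s : ℂ) - t) +
      (conj (f α c s t 1) * deriv (fun l : ℝ => f α c s t l) 1
          + g α c s t 1 * deriv (fun l : ℝ => conj (g α c s t l)) 1)
        / (f α c s t 1 * conj (f α c s t 1) + g α c s t 1 * conj (g α c s t 1)) := by
  have hpos := detFun_pos hinj him 1
  have hsqrt := Real.sqrt_pos.2 hpos
  have he := expFun_ne_zero s t 1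
  have e' := hasDerivAt_expFun_ofReal s t
  have i' := e'.fun_inv (by simpa using he)
  have f' := hasDerivAt_f (α := α) (c := c) s t
  have g' := hasDerivAt_g (α := α) (c := c) s t
  have cf' := f'.star
  have cg' := g'.star
  have R' : HasDerivAt (fun l : ℝ => (((Real.sqrt (detFun α l))⁻¹ : ℝ) : ℂ))
      ((deriv (fun l : ℝ => (Real.sqrt (detFun α l))⁻¹) 1 : ℝ) : ℂ) 1 := by
    refine HasDerivAt.ofReal_comp (DifferentiableAt.hasDerivAt ?_)
    exact (((contDiff_detFun.differentiable (by simp)) 1).sqrt hpos.ne').inv hsqrt.ne'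
  have hD : f α c s t 1 * conj (f α c s t 1) + g α c s t 1 * conj (g α c s t 1) =
      (detFun α 1 : ℂ) := by
    rw [← detFun_eq (c := c) hinj s t 1, Complex.mul_conj', Complex.mul_conj']
    push_cast
    rfl
  have hRD : (((Real.sqrt (detFun α 1))⁻¹ : ℝ) : ℂ) ^ 2 = (detFun α 1 : ℂ)⁻¹ := by
    rw [← Complex.ofReal_pow, inv_pow, Real.sq_sqrt hpos.le, Complex.ofReal_inv]
  have hDne : (detFun α 1 : ℂ) ≠ 0 := Complex.ofReal_ne_zero.2 hpos.ne'
  have hce : conj (expFun s t 1) = (expFun s t 1)⁻¹ := by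
    simpa using conj_expFun_ofReal s t 1
  have cfd : deriv (fun l : ℝ => conj (f α c s t l)) 1 =
      conj (deriv (fun l : ℝ => f α c s t l) 1) := cf'.deriv
  have cgd : deriv (fun l : ℝ => conj (g α c s t l)) 1 =
      conj (deriv (fun l : ℝ => g α c s t l) 1) := cg'.deriv
  have D00 := (R'.fun_mul (f'.fun_mul e')).deriv
  have D01 := (R'.fun_mul (cg'.fun_neg.fun_mul e')).deriv
  have D10 := (R'.fun_mul (g'.fun_mul i')).deriv
  have D11 := (R'.fun_mul (cf'.fun_mul i')).deriv
  simp only [Complex.star_def, Complex.ofReal_one] at D00 D01 D10 D11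
  rw [symFormula_eq fun s t l _ => frame_mem hinj him s t l]
  simp only [Matrix.mul_apply, Fin.sum_univ_two, spectralDeriv, Matrix.of_apply,
    Matrix.conjTranspose_apply, frame_eq_f_g hinj, Matrix.smul_apply, Matrix.cons_val',
    Matrix.cons_val_zero, Matrix.cons_val_one, Matrix.cons_val_fin_one, smul_eq_mul,
    Complex.ofReal_one, Complex.star_def, map_mul, map_neg, Complex.conj_conj,
    Complex.conj_ofReal, hce]
  rw [D00, D01, D10, D11, cfd, cgd, hD]
  constructor
  · rw [div_eq_mul_inv _ (detFun α 1 : ℂ), ← hRD]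
    field_simp
    ring
  -- The scalar is the logarithmic derivative `R'/R`, written as `R R' det Ψ` by means of `R² det Ψ
  -- = 1`.
  · refine ⟨(Real.sqrt (detFun α 1))⁻¹ * deriv (fun l : ℝ => (Real.sqrt (detFun α l))⁻¹) 1 *
      detFun α 1, ?_⟩
    rw [Complex.ofReal_mul, Complex.ofReal_mul, div_eq_mul_inv _ (detFun α 1 : ℂ), ← hRD]
    have hone : (((Real.sqrt (detFun α 1))⁻¹ : ℝ) : ℂ) ^ 2 *
        (f α c s t 1 * conj (f α c s t 1) + g α c s t 1 * conj (g α c s t 1)) = 1 := by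
      rw [hRD, hD, inv_mul_cancel₀ hDne]
    have hee := mul_inv_cancel₀ he
    rw [← hD]
    generalize (((Real.sqrt (detFun α 1))⁻¹ : ℝ) : ℂ) = R at hone ⊢
    generalize ((deriv (fun l : ℝ => (Real.sqrt (detFun α l))⁻¹) 1 : ℝ) : ℂ) = R₁
    set S := f α c s t 1 * conj (f α c s t 1) + g α c s t 1 * conj (g α c s t 1) with hS
    linear_combination (R * R₁ * S + R ^ 2 *
      (conj (f α c s t 1) * deriv (fun l : ℝ => f α c s t l) 1 +
        g α c s t 1 * conj (deriv (fun l : ℝ => g α c s t l) 1)) +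
      Complex.I / 2 * ((s : ℂ) - t) * R ^ 2 * S) * hee + Complex.I / 2 * ((s : ℂ) - t) * hone

end Frame

end LundRegge

/-! ### The proposition on `N`-soliton curves -/

open LundRegge in
theorem proposition3p11 (N : ℕ) (hN : 0 < N) (α c : Fin N → ℂ)
    (hα : Function.Injective α)
    (him : (∀ j, 0 < (α j).im) ∨ (∀ j, (α j).im < 0)) :
    -- the linear system of the construction is non-singular, and `Ψ` is Date's wave function
    (∀ s t : ℝ, d α c 0 s t ≠ 0) ∧
    (∀ (s t : ℝ) (j : Fin N), Matrix.vecMul ![1, c j] (Psi α c s t (α j)) = 0) ∧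
    (∀ l : ℂ, l ≠ 0 → SolvesLaxPair (fun s t => Psi α c s t l)
      (fun s t => dateL α c s t l) (fun s t => dateM α c s t l)) ∧
    -- the expansions of `f` and `g`
    (∀ (s t : ℝ) (l : ℂ), l ≠ 0 →
      f α c s t l = l ^ N +
        ∑ j : Fin N, d α c ((j : ℕ) + 1) s t / d α c 0 s t * l ^ (j : ℕ) ∧
      g α c s t l =
        -∑ j : Fin N, d α c (N + (j : ℕ) + 1) s t / d α c 0 s t * l ^ (j : ℕ)) ∧
    -- the normalized wave function is a smooth `SU(2)`-valued family for `λ > 0` that solves the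
    -- Lax pair of the solution `q` of the Pohlmeyer-Lund-Regge equation
    (∀ s t l : ℝ, 0 < l →
      (Psi α c s t (l : ℂ)).det = ((‖f α c s t l‖ ^ 2 + ‖g α c s t l‖ ^ 2 : ℝ) : ℂ) ∧
      0 < ‖f α c s t l‖ ^ 2 + ‖g α c s t l‖ ^ 2 ∧
      frame α c s t l ∈ Matrix.specialUnitaryGroup (Fin 2) ℂ) ∧
    (∀ i j : Fin 2, ContDiffOn ℝ ∞
      (fun p : ℝ × ℝ × ℝ => frame α c p.1 p.2.1 p.2.2 i j) {p | 0 < p.2.2}) ∧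
    (∃ h : ℝ → ℝ → ℝ, IsPLRSolution (solitonSolution α c) h ∧
      ∀ l : ℝ, 0 < l → SolvesLaxPair (fun s t => frame α c s t l)
        (laxL (solitonSolution α c) l) (laxM (solitonSolution α c) h l)) ∧
    -- the `N`-soliton curve is the Sym formula under `ℝ³ ≅ 𝔰𝔲(2)`, and it is a unit-speed
    -- Lund-Regge evolution
    (∀ s t : ℝ, su2OfR3 (solitonCurve α c s t) = symFormula (frame α c) s t) ∧
    IsLundReggeEvolution (solitonCurve α c) ∧
    HasUnitSpeed (solitonCurve α c) ∧
    -- the explicit formula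
    (∀ s t : ℝ,
      solitonCurve α c s t 0 =
        2 * ((conj (f α c s t 1) * deriv (fun l : ℝ => g α c s t l) 1
              - g α c s t 1 * deriv (fun l : ℝ => conj (f α c s t l)) 1)
            / (f α c s t 1 * conj (f α c s t 1) + g α c s t 1 * conj (g α c s t 1))
            * conj (expFun s t 1) ^ 2).re ∧
      solitonCurve α c s t 1 =
        -2 * ((conj (f α c s t 1) * deriv (fun l : ℝ => g α c s t l) 1
              - g α c s t 1 * deriv (fun l : ℝ => conj (f α c s t l)) 1)
            / (f α c s t 1 * conj (f α c s t 1) + g α c s t 1 * conj (g α c s t 1))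
            * conj (expFun s t 1) ^ 2).im ∧
      solitonCurve α c s t 2 =
        s - t + 2 * ((conj (f α c s t 1) * deriv (fun l : ℝ => f α c s t l) 1
              + g α c s t 1 * deriv (fun l : ℝ => conj (g α c s t l)) 1)
            / (f α c s t 1 * conj (f α c s t 1) + g α c s t 1 * conj (g α c s t 1))).im) := by
  have hinj := node_injective hα him
  have him' := node_im_ne_zero him
  have h0 := node_ne_zero him
  have hF : ∀ i j, ContDiffOn ℝ ∞
      (fun p : ℝ × ℝ × ℝ => frame α c p.1 p.2.1 p.2.2 i j) {p | 0 < p.2.2} :=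
    contDiffOn_frame hinj him'
  have hSU : ∀ s t l : ℝ, 0 < l → frame α c s t l ∈ Matrix.specialUnitaryGroup (Fin 2) ℂ :=
    fun s t l _ => frame_mem hinj him' s t l
  have hLax := fun (l : ℝ) (hl : 0 < l) => frame_solvesLaxPair (c := c) hN hinj h0 hl
  refine ⟨d_zero_ne_zero hinj, vecMul_Psi hinj, fun l hl => Psi_solvesLaxPair hN hinj h0 hl,
    fun s t l _ => ⟨?_, ?_⟩, fun s t l hl => ⟨det_Psi s t l, ?_, hSU s t l hl⟩, hF,
    ⟨_, isPLRSolution hN hinj h0, hLax⟩, fun s t => ?_,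
    isLundReggeEvolution_symFormula hF hSU hLax, hasUnitSpeed_symFormula hF hSU hLax,
    fun s t => ?_⟩
  · rw [f_eq, polyLeft, Polynomial.eval_add, eval_coeffPoly, Polynomial.eval_pow,
      Polynomial.eval_X]
    rfl
  · rw [g_eq, polyRight, eval_coeffPoly]
    rfl
  · rw [detFun_eq hinj]
    exact detFun_pos hinj him' l
  · exact su2OfR3_r3OfSu2 (conjTranspose_symFormula hF hSU s t) (trace_symFormula hF hSU s t)
  · obtain ⟨h10, r, h00⟩ := symFormula_frame (c := c) hinj him' s t
    refine ⟨?_, ?_, ?_⟩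
    · rw [← h10]
      rfl
    · rw [← h10]
      rfl
    · change 2 * (symFormula (frame α c) s t 0 0).im = _
      rw [h00]
      have hI : (Complex.I / 2 * ((s : ℂ) - t)).im = (s - t) / 2 := by
        rw [div_mul_eq_mul_div, ← Complex.ofReal_sub, Complex.div_ofNat_im, Complex.I_mul_im,
          Complex.ofReal_re]
      rw [Complex.add_im, Complex.add_im, Complex.ofReal_im, hI]
      ring
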